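/- **Setting.** Let $d\ge 1$, $n\ge 0$, $r\ge 0$. Spacetime is $\mathbb R^d$ with Minkowski metric $\eta=\mathrm{diag}(1,-1,\dots,-1)$; the fields are smooth maps $\phi:\mathbb R^d\to V=\mathbb R^n$ ($n$ real scalar flavours), regarded as sections of $\mathbb R^d\times V\to\mathbb R^d$. The internal symmetry is an arbitrary group $G$ acting on $V$ by an arbitrary linear representation $\rho$ (the trivial group is allowed). An *operator* with $N$ fields and $2k$ derivatives is $t_{i_1\dots i_N}(\partial\cdots\partial\phi^{i_1})\cdots(\partial\cdots\partial\phi^{i_N})$, where $t$ is a constant flavour tensor and the $2k$ derivatives, distributed over the $N$ fields in any way, are contracted in pairs with $\eta^{-1}$. It is *box-free* if no contracted pair of derivatives acts on one and the same field. *Lagrangians with up to $2(r+1)$ derivatives* are finite linear combinations of such expressions with $k\le r+1$, any $N$, and with the $t_{i_1\dots i_N}$ allowed to be smooth functions of $\phi$. A functional $L$ is $G$-invariant if $L[\rho(g)\phi]=L[\phi]$ for all $g$ and $\phi$. Two functionals are equal *modulo integration by parts* (IBP) if they differ by $\sum_\mu\partial_\mu J^\mu[\phi]$ with each $J^\mu$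 a local functional, i.e. a finite linear combination of terms $A(\phi)\prod_j\partial_{\alpha_j}\phi^{i_j}$ with $A$ smooth. The $r$-jet bundle $J^r$ has coordinates $(x^\mu,u^i,u^i_{\mu_1},\dots,u^i_{\mu_1\dots\mu_r})$, symmetric in the lower indices, and $j^r\phi$ is the prolongation of $\phi$. An *$r$-jet metric* is a smooth symmetric $(0,2)$-tensor $g$ on $J^r$ (all components are arbitrary functions on $J^r$; non-degeneracy is not imposed). Its Lagrangian is $\mathcal L[\phi,g]=\tfrac12\langle\eta^{-1},(j^r\phi)^*g\rangle$. Call $g$ *invariant* if it is preserved by the prolonged actions on $J^r$ of the Poincaré group $\mathbb R^d\rtimes O(1,d-1)$ and of $G$. **Theorem.** 1. (a) There is a set $\mathcal B$ of box-free operators, each with a $G$-invariant flavour tensor, at most $2(r+1)$ derivatives, and no field carrying more than $r+1$ derivatives, which is a Green's basis: $\mathcal B$ is linearly independent modulo IBP, and for all $N$ and all $k\le r+1$, every $G$-invariant linear combination of operators with $N$ fields and $2k$ derivatives equals, modulo IBP, a linear combination of elements of $\mathcal B$ with $N$ fields and $2k$ derivatives. (b) Likewise, every $G$-invariant Lagrangian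 with up to $2(r+1)$ derivatives equals, modulo IBP, a $G$-invariant Lagrangian with up to $2(r+1)$ derivatives whose terms are all box-free with at most $r+1$ derivatives on each field. 2. Every $G$-invariant Lagrangian with up to $2(r+1)$ derivatives, any number of fields, whose terms are all box-free with at most $r+1$ derivatives on each field (in particular every such operator), is equal to $\mathcal L[\phi,g]$ for some invariant $r$-jet metric $g$. 3. Consequently the map $g\mapsto\mathcal L[\phi,g]$ is surjective modulo IBP: for every $G$-invariant Lagrangian $L$ with up to $2(r+1)$ derivatives there is an invariant $r$-jet metric $g$ such that $L=\mathcal L[\,\cdot\,,g]$ modulo IBP. -/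

import Mathlib

open scoped ContDiff

namespace JetEFT

noncomputable section

/-- Spacetime `ℝ^d`, with coordinates `x^μ`; `μ = 0` is the time direction. -/
abbrev Spacetime (d : ℕ) := Fin d → ℝ

/-- The space `ℝ^n` of values of `n` real scalar fields (flavours). -/
abbrev FieldSpace (n : ℕ) := Fin n → ℝ

/-- The Minkowski metric `η = diag(1, -1, …, -1)`. -/
def minkowski (d : ℕ) : Matrix (Fin d) (Fin d) ℝ :=
  Matrix.diagonal fun μ => if (μ : ℕ) = 0 then 1 else -1

/-- The coordinate vector `∂/∂x^μ`. -/
def basisVec {d : ℕ} (μ : Fin d) : Spacetime d := Pi.single μ 1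

/-- Scalar field configurations: smooth sections `x ↦ (x, φ x)` of `ℝ^d × ℝ^n → ℝ^d`. -/
abbrev Config (d n : ℕ) := {φ : Spacetime d → FieldSpace n // ContDiff ℝ ∞ φ}

/-- Functions of spacetime that depend on a field configuration; Lagrangians and operators are
such functionals. -/
abbrev Functional (d n : ℕ) := Config d n → Spacetime d → ℝ

/-! ### Derivatives, local functionals and integration by parts -/

/-- The partial derivative `∂_μ f`. -/
def partialD {d : ℕ} (μ : Fin d) (f : Spacetime d → ℝ) : Spacetime d → ℝ :=
  fun x => fderiv ℝ f x (basisVec μ)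

/-- The iterated partial derivative `∂_{μ₁} ⋯ ∂_{μ_k} f` along a list of indices. -/
def iterD {d : ℕ} (l : List (Fin d)) (f : Spacetime d → ℝ) : Spacetime d → ℝ :=
  l.foldr partialD f

/-- The `i`-th flavour component `φ^i`. -/
def Config.component {d n : ℕ} (φ : Config d n) (i : Fin n) : Spacetime d → ℝ :=
  fun x => φ.1 x i

/-- Local functionals: linear combinations of `A(φ) ∏_j ∂_{α_j} φ^{i_j}` with `A` smooth and
arbitrary lists `α_j` of (uncontracted) spacetime indices. -/
def localFunctionals (d n : ℕ) : Submodule ℝ (Functional d n) :=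
  Submodule.span ℝ {F | ∃ (N : ℕ) (A : FieldSpace n → ℝ) (i : Fin N → Fin n)
    (α : Fin N → List (Fin d)), ContDiff ℝ ∞ A ∧
      F = fun φ x => A (φ.1 x) * ∏ j, iterD (α j) (φ.component (i j)) x}

/-- Total derivatives `∑_μ ∂_μ J^μ` of local functionals `J^μ`. Two Lagrangians are related by
integration by parts when they differ by an element of this space. -/
def totalDerivatives (d n : ℕ) : Submodule ℝ (Functional d n) :=
  Submodule.span ℝ {F | ∃ (μ : Fin d) (J : Functional d n), J ∈ localFunctionals d n ∧
    F = fun φ => partialD μ (J φ)}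

/-! ### Lorentz-invariant operators -/

/-- A pattern of Lorentz contractions: `N` fields and `k` contracted pairs of derivatives. The pair
`e` consists of a derivative `∂_μ` on the field `src e` and a derivative `∂_ν` on the field `tgt e`,
contracted with `η^{μν}`. -/
structure Contraction (N k : ℕ) where
  src : Fin k → Fin N
  tgt : Fin k → Fin N

namespace Contraction

variable {N k : ℕ}

/-- No box: no contracted pair of derivatives acts on one and the same field. -/
def BoxFree (Γ : Contraction N k) : Prop := ∀ e, Γ.src e ≠ Γ.tgt e

/-- The number of derivatives acting on the `j`-th field. -/
def numDerivs (Γ : Contraction N k) (j : Fin N) : ℕ :=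
  (Finset.univ.filter fun e => Γ.src e = j).card + (Finset.univ.filter fun e => Γ.tgt e = j).card

/-- The list of the indices of the derivatives on the `j`-th field, when the pair `e` carries the
indices `μ e` and `ν e`. -/
def indicesAt {d : ℕ} (Γ : Contraction N k) (μ ν : Fin k → Fin d) (j : Fin N) : List (Fin d) :=
  (List.finRange k).flatMap fun e =>
    (if Γ.src e = j then [μ e] else []) ++ (if Γ.tgt e = j then [ν e] else [])

/-- The contraction, with `η^{-1}`, of the derivatives of scalar functions `f_1, …, f_N`. -/
def contract {d : ℕ} (Γ : Contraction N k) (f : Fin N → Spacetime d → ℝ) (x : Spacetime d) : ℝ :=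
  ∑ μ : Fin k → Fin d, ∑ ν : Fin k → Fin d,
    (∏ e, (minkowski d)⁻¹ (μ e) (ν e)) * ∏ j, iterD (Γ.indicesAt μ ν j) (f j) x

/-- The Lagrangian term with contraction pattern `Γ` and flavour tensor `t_{i_1 … i_N}(φ)`:
`∑_i t_{i_1 … i_N}(φ) ∂…φ^{i_1} ⋯ ∂…φ^{i_N}`. -/
def term (d : ℕ) {n : ℕ} (Γ : Contraction N k)
    (t : FieldSpace n → ContinuousMultilinearMap ℝ (fun _ : Fin N => FieldSpace n) ℝ) :
    Functional d n :=
  fun φ x => ∑ i : Fin N → Fin n,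
    t (φ.1 x) (fun j => Pi.single (i j) 1) * Γ.contract (fun j => φ.component (i j)) x

end Contraction

/-- An operator: a product of `N` fields with `2 k` derivatives, all Lorentz indices being
contracted with `η^{-1}` and all flavour indices with a constant tensor. -/
structure Operator (n : ℕ) where
  N : ℕ
  k : ℕ
  graph : Contraction N k
  tensor : ContinuousMultilinearMap ℝ (fun _ : Fin N => FieldSpace n) ℝ

/-- The operator as a functional of the fields. -/
def Operator.functional (d : ℕ) {n : ℕ} (O : Operator n) : Functional d n :=
  O.graph.term d fun _ => O.tensor

/-- Lorentz-invariant Lagrangians with exactly `N` fields and `2 k` derivatives. -/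
def homogeneousLagrangians (d n N k : ℕ) : Submodule ℝ (Functional d n) :=
  Submodule.span ℝ {F | ∃ (Γ : Contraction N k)
    (t : ContinuousMultilinearMap ℝ (fun _ : Fin N => FieldSpace n) ℝ), F = Γ.term d fun _ => t}

/-- Lorentz-invariant Lagrangians with at most `2 (r + 1)` derivatives. The coefficients are smooth
functions of the fields, so that any number of field insertions is allowed. -/
def lagrangians (d n r : ℕ) : Submodule ℝ (Functional d n) :=
  Submodule.span ℝ {F | ∃ (N k : ℕ) (Γ : Contraction N k)
    (t : FieldSpace n → ContinuousMultilinearMap ℝ (fun _ : Fin N => FieldSpace n) ℝ),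
      k ≤ r + 1 ∧ ContDiff ℝ ∞ t ∧ F = Γ.term d t}

/-- Those Lagrangians with at most `2 (r + 1)` derivatives all of whose terms are free of boxes and
have at most `r + 1` derivatives on each field. -/
def boxFreeLagrangians (d n r : ℕ) : Submodule ℝ (Functional d n) :=
  Submodule.span ℝ {F | ∃ (N k : ℕ) (Γ : Contraction N k)
    (t : FieldSpace n → ContinuousMultilinearMap ℝ (fun _ : Fin N => FieldSpace n) ℝ),
      k ≤ r + 1 ∧ Γ.BoxFree ∧ (∀ j, Γ.numDerivs j ≤ r + 1) ∧ ContDiff ℝ ∞ t ∧ F = Γ.term d t}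

/-! ### Internal symmetries -/

/-- The action of an internal symmetry on flavour space, as a continuous linear map. -/
def flavourMap {n : ℕ} {G : Type*} [Group G] (ρ : Representation ℝ G (FieldSpace n)) (g : G) :
    FieldSpace n →L[ℝ] FieldSpace n :=
  LinearMap.toContinuousLinearMap (ρ g)

/-- The transformed configuration `x ↦ ρ(g) (φ x)`. -/
def Config.transform {d n : ℕ} {G : Type*} [Group G] (ρ : Representation ℝ G (FieldSpace n))
    (g : G) (φ : Config d n) : Config d n :=
  ⟨fun x => flavourMap ρ g (φ.1 x), (flavourMap ρ g).contDiff.comp φ.2⟩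

/-- Invariance of a Lagrangian under the internal symmetry. -/
def Functional.IsInvariant {d n : ℕ} {G : Type*} [Group G]
    (ρ : Representation ℝ G (FieldSpace n)) (L : Functional d n) : Prop :=
  ∀ (g : G) (φ : Config d n), L (φ.transform ρ g) = L φ

/-- The flavour tensor of the operator is an invariant tensor of the internal symmetry. -/
def Operator.IsInvariant {n : ℕ} {G : Type*} [Group G]
    (ρ : Representation ℝ G (FieldSpace n)) (O : Operator n) : Prop :=
  ∀ (g : G) (v : Fin O.N → FieldSpace n), O.tensor (fun j => ρ g (v j)) = O.tensor v

/-! ### Jet bundles -/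

/-- The iterated derivative of a smooth function is symmetric. -/
theorem iteratedFDeriv_perm {E : Type} [NormedAddCommGroup E] [NormedSpace ℝ E] (k : ℕ) :
    ∀ {F : Type} [NormedAddCommGroup F] [NormedSpace ℝ F] {f : E → F}, ContDiff ℝ ∞ f →
      ∀ (σ : Equiv.Perm (Fin k)) (x : E) (v : Fin k → E),
        iteratedFDeriv ℝ k f x (v ∘ σ) = iteratedFDeriv ℝ k f x v := by
  induction k with
  | zero => intro F _ _ f _ σ x v; congr 1; ext i; exact i.elim0
  | succ k ih =>
    intro F _ _ f hf σ
    have hmem : σ ∈ Submonoid.closure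
        (Set.range fun i : Fin k => Equiv.swap i.castSucc i.succ) := by
      rw [Equiv.Perm.mclosure_swap_castSucc_succ]; trivial
    induction hmem using Submonoid.closure_induction with
    | one => intro x v; rfl
    | mul a b _ _ ha hb =>
      intro x v
      have h := hb x (v ∘ a)
      rw [ha] at h
      exact h
    | mem a h =>
      obtain ⟨i, rfl⟩ := h
      intro x v
      have hd : Differentiable ℝ (iteratedFDeriv ℝ k f) :=
        hf.differentiable_iteratedFDeriv (by exact_mod_cast WithTop.coe_lt_top k)
      by_cases hi : (i : ℕ) = 0
      · by_cases hk : k = 1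
        · subst hk
          have h2 := (hf.contDiffAt (x := x)).isSymmSndFDerivAt
            (by rw [minSmoothness_of_isRCLikeNormedField]
                exact ENat.LEInfty.out) (v 0) (v 1)
          obtain rfl : i = 0 := Subsingleton.elim _ _
          rw [iteratedFDeriv_two_apply, iteratedFDeriv_two_apply]
          simpa using h2.symm
        · have hik := i.2
          have hf' : ContDiff ℝ ∞ (fun y => fderiv ℝ f y) := hf.fderiv_right (by simp)
          have h := ih hf' (Equiv.swap i ⟨1, by omega⟩) x (Fin.init v)
          rw [iteratedFDeriv_succ_apply_right, iteratedFDeriv_succ_apply_right, ← h]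
          congr 2
          · funext j
            simp only [Fin.init, Function.comp, Equiv.swap_apply_def, Fin.ext_iff,
              Fin.val_castSucc, Fin.val_succ, hi]
            split_ifs <;> first | rfl | (congr 1; ext; simp; omega) | (exfalso; omega)
          · simp only [Function.comp, Equiv.swap_apply_def, Fin.ext_iff,
              Fin.val_castSucc, Fin.val_succ, Fin.val_last, hi]
            split_ifs <;> first | rfl | (exfalso; omega)
      · have hik := i.2
        have key : ∀ w : Fin k → E, ∀ u : E,
            fderiv ℝ (iteratedFDeriv ℝ k f) x u
              (w ∘ Equiv.swap (⟨i - 1, by omega⟩ : Fin k) i) =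
            fderiv ℝ (iteratedFDeriv ℝ k f) x u w := by
          intro w u
          have e : ∀ w' : Fin k → E, fderiv ℝ (iteratedFDeriv ℝ k f) x u w' =
              fderiv ℝ (fun y => iteratedFDeriv ℝ k f y w') x u := by
            intro w'
            rw [((hd x).hasFDerivAt.continuousMultilinear_apply_const w').fderiv]
            rfl
          rw [e, e]
          congr 2
          funext y
          exact ih hf _ y w
        rw [iteratedFDeriv_succ_apply_left, iteratedFDeriv_succ_apply_left, ← key (Fin.tail v)]
        have h0 : Equiv.swap i.castSucc i.succ 0 = 0 :=
          Equiv.swap_apply_of_ne_of_ne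
            (fun h => hi (by simpa using (congrArg Fin.val h).symm)) (Fin.succ_ne_zero i).symm
        simp only [Function.comp_apply, h0]
        congr 1
        · funext j
          simp only [Fin.tail, Function.comp, Equiv.swap_apply_def, Fin.ext_iff,
              Fin.val_castSucc, Fin.val_succ]
          split_ifs <;> first | rfl | (congr 1; ext; simp; omega) | (exfalso; omega)

/-- Symmetric `k`-linear maps from spacetime vectors to field space, as a subspace of all
`k`-linear maps. -/
def symTensorSubmodule (d n k : ℕ) :
    Submodule ℝ (ContinuousMultilinearMap ℝ (fun _ : Fin k => Spacetime d) (FieldSpace n)) where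
  carrier := {f | ∀ (σ : Equiv.Perm (Fin k)) (v : Fin k → Spacetime d), f (v ∘ σ) = f v}
  zero_mem' := fun _ _ => rfl
  add_mem' := fun ha hb σ v => congrArg₂ (· + ·) (ha σ v) (hb σ v)
  smul_mem' := fun c _ ha σ v => congrArg (c • ·) (ha σ v)

/-- The space of the jet coordinates `u^i_{μ_1 … μ_k}`. -/
def SymTensor (d n k : ℕ) : Type := symTensorSubmodule d n k

instance (d n k : ℕ) : NormedAddCommGroup (SymTensor d n k) :=
  inferInstanceAs (NormedAddCommGroup (symTensorSubmodule d n k))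

instance (d n k : ℕ) : NormedSpace ℝ (SymTensor d n k) :=
  inferInstanceAs (NormedSpace ℝ (symTensorSubmodule d n k))

/-- A symmetric multilinear map as an element of `SymTensor`. -/
def SymTensor.mk {d n k : ℕ}
    (f : ContinuousMultilinearMap ℝ (fun _ : Fin k => Spacetime d) (FieldSpace n))
    (hf : ∀ (σ : Equiv.Perm (Fin k)) (v : Fin k → Spacetime d), f (v ∘ σ) = f v) :
    SymTensor d n k :=
  ⟨f, hf⟩

/-- The underlying multilinear map. -/
def SymTensor.toMultilinear {d n k : ℕ} (u : SymTensor d n k) :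
    ContinuousMultilinearMap ℝ (fun _ : Fin k => Spacetime d) (FieldSpace n) :=
  Subtype.val u

theorem SymTensor.symmetric {d n k : ℕ} (u : SymTensor d n k) (σ : Equiv.Perm (Fin k))
    (v : Fin k → Spacetime d) : u.toMultilinear (v ∘ σ) = u.toMultilinear v :=
  Subtype.property u σ v

/-- The `r`-jet bundle of `ℝ^d × ℝ^n → ℝ^d` in its global coordinates
`(x^μ, u^i, u^i_{μ_1}, …, u^i_{μ_1 … μ_r})`. -/
abbrev Jet (d n r : ℕ) := Spacetime d × ((k : Fin (r + 1)) → SymTensor d n (k : ℕ))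

/-- The prolongation `j^r φ` of a section `φ`: its coordinates are the partial derivatives of `φ`
of order at most `r`. -/
def prolong {d n : ℕ} (r : ℕ) (φ : Config d n) (x : Spacetime d) : Jet d n r :=
  (x, fun k => SymTensor.mk (iteratedFDeriv ℝ (k : ℕ) φ.1 x)
    fun σ v => iteratedFDeriv_perm k φ.2 σ x v)

/-- The prolongation to the `r`-jet bundle of the bundle morphism `(x, u) ↦ (Λ x + a, T u)`; it maps
the `r`-jet of `φ` at `x` to the `r`-jet of `y ↦ T (φ (Λ⁻¹ (y - a)))` at `Λ x + a`. -/
def Jet.map {d n r : ℕ} (Λ : Spacetime d ≃L[ℝ] Spacetime d) (a : Spacetime d)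
    (T : FieldSpace n →L[ℝ] FieldSpace n) (p : Jet d n r) : Jet d n r :=
  (Λ p.1 + a, fun k => SymTensor.mk
    (T.compContinuousMultilinearMap ((p.2 k).toMultilinear.compContinuousLinearMap
      fun _ => (Λ.symm : Spacetime d →L[ℝ] Spacetime d)))
    fun σ v => congrArg T ((p.2 k).symmetric σ fun j => Λ.symm (v j)))

/-- `Λ` preserves the Minkowski metric. -/
def IsLorentz {d : ℕ} (Λ : Spacetime d ≃L[ℝ] Spacetime d) : Prop :=
  ∀ v w, Λ v ⬝ᵥ (minkowski d).mulVec (Λ w) = v ⬝ᵥ (minkowski d).mulVec w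

/-- The most general metric on the `r`-jet bundle: a smooth symmetric `(0,2)`-tensor whose
components are arbitrary functions on the jet bundle. Non-degeneracy is not imposed (a Lagrangian
such as a bare potential only arises from singular component matrices). -/
structure JetMetric (d n r : ℕ) where
  toFun : Jet d n r → Jet d n r →L[ℝ] Jet d n r →L[ℝ] ℝ
  smooth : ContDiff ℝ ∞ toFun
  symm : ∀ p v w, toFun p v w = toFun p w v

namespace JetMetric

variable {d n r : ℕ}

/-- The metric is preserved by the map `Φ` of the jet bundle, that is `Φ^* g = g`. -/
def PreservedBy (g : JetMetric d n r) (Φ : Jet d n r → Jet d n r) : Prop :=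
  ∀ p v w, g.toFun (Φ p) (fderiv ℝ Φ p v) (fderiv ℝ Φ p w) = g.toFun p v w

/-- Invariance under the prolonged action of the Poincaré group. -/
def PoincareInvariant (g : JetMetric d n r) : Prop :=
  ∀ (Λ : Spacetime d ≃L[ℝ] Spacetime d) (a : Spacetime d), IsLorentz Λ →
    g.PreservedBy (Jet.map Λ a (ContinuousLinearMap.id ℝ (FieldSpace n)))

/-- Invariance under the prolonged action of the internal symmetry. -/
def InternalInvariant {G : Type*} [Group G] (ρ : Representation ℝ G (FieldSpace n))
    (g : JetMetric d n r) : Prop :=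
  ∀ h : G, g.PreservedBy (Jet.map (ContinuousLinearEquiv.refl ℝ (Spacetime d)) 0 (flavourMap ρ h))

/-- The pullback `(j^r φ)^* g`, a symmetric `(0,2)`-tensor on spacetime. -/
def pullback (g : JetMetric d n r) (φ : Config d n) (x v w : Spacetime d) : ℝ :=
  g.toFun (prolong r φ x) (fderiv ℝ (prolong r φ) x v) (fderiv ℝ (prolong r φ) x w)

/-- The Lagrangian `½ ⟨η^{-1}, (j^r φ)^* g⟩` of a jet bundle metric. -/
def lagrangian (g : JetMetric d n r) : Functional d n := fun φ x =>
  (1 / 2) * ∑ μ, ∑ ν, (minkowski d)⁻¹ μ ν * g.pullback φ x (basisVec μ) (basisVec ν)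

end JetMetric

end

end JetEFT

namespace JetEFT

noncomputable section

/-! ### Iterated partial derivatives -/

/-! Removing boxes. If both ends of a contracted pair sit on one field, take one end off and
integrate by parts. By the Leibniz rule the sum over all fields that may receive this derivative,
plus a term in which it hits the coefficient `t(φ)`, is a total derivative
(`sum_retarget_add_detach_mem`). One summand is the original term; every other has fewer boxes, so
induction on `numBoxes` ends at box-free terms. A box-free pattern with `k` pairs puts at most `k`
derivatives on each field, so the bound `r + 1` per field is automatic.

Invariant tensors. `G` is arbitrary, so tensors cannot be averaged over it. A Lagrangian determines
its flavour tensors up to two ambiguities: simultaneous relabelling of fields and flavours, and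
linear relations between contraction patterns. Symmetrising and then expanding along a fixed linear
section removes both (`canonical`): the result represents the same Lagrangian, is linear in the
tensors, commutes with linear maps of flavour space, and vanishes when the multilinear expansion
does (`canonical_eq_zero`). Invariance of the Lagrangian therefore passes to its canonical tensors.
For field-dependent coefficients, undifferentiated fields are first absorbed into `t(φ)`; afterwards
the value of the field at a point and its derivatives there can be varied independently
(`canonical_tensorInvariant`). Box removal preserves covariance of the tensors, because the
derivative of a covariant tensor is covariant.

Green's basis. For each pair `(N, k)` a maximal subset of the invariant box-free operators that is
independent modulo total derivatives is chosen. Distinct sectors are independent because `φ(x) ↦ 2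
φ(3x)` acts on them, modulo total derivatives, by the distinct eigenvalues `2^N * 3^(2k)`.

Metrics. In a box-free term with at least one pair, the ends of pair `0` lie on different fields.
Putting two tangent vectors of the jet bundle in these two slots, and the jet itself in all others,
gives a bilinear form. On tangent vectors of a prolonged section it supplies one extra derivative on
each of the two fields, and the trace with `η^{-1}` contracts them, restoring the pair
(`metric_lagrangian`). The at most `r` remaining pairs need only jet coordinates of order at most
`r`. Lorentz invariance of contractions and covariance of the tensor make the metric invariant.
Terms without derivatives come from `(2 / d) V η`. -/

theorem contDiff_partialD {d : ℕ} (μ : Fin d) {f : Spacetime d → ℝ} (hf : ContDiff ℝ ∞ f) :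
    ContDiff ℝ ∞ (partialD μ f) :=
  (hf.fderiv_right (m := ∞) (by simp)).clm_apply contDiff_const

theorem contDiff_iterD {d : ℕ} (l : List (Fin d)) {f : Spacetime d → ℝ} (hf : ContDiff ℝ ∞ f) :
    ContDiff ℝ ∞ (iterD l f) := by
  induction l with
  | nil => exact hf
  | cons μ l ih => exact contDiff_partialD μ ih

theorem iterD_cons {d : ℕ} (μ : Fin d) (l : List (Fin d)) (f : Spacetime d → ℝ) :
    iterD (μ :: l) f = partialD μ (iterD l f) := rfl

theorem partialD_comm {d : ℕ} (μ ν : Fin d) {f : Spacetime d → ℝ} (hf : ContDiff ℝ ∞ f) :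
    partialD μ (partialD ν f) = partialD ν (partialD μ f) := by
  have hd : Differentiable ℝ (fderiv ℝ f) :=
    (hf.fderiv_right (m := ∞) (by simp)).differentiable (by simp)
  have key : ∀ (α β : Fin d) (x : Spacetime d), partialD α (partialD β f) x =
      fderiv ℝ (fderiv ℝ f) x (basisVec α) (basisVec β) := by
    intro α β x
    have h := (hd x).hasFDerivAt.clm_apply (hasFDerivAt_const (basisVec β) x)
    unfold partialD
    rw [h.fderiv]
    simp
  funext x
  rw [key, key]
  exact (hf.contDiffAt (x := x)).isSymmSndFDerivAt
    (by rw [minSmoothness_of_isRCLikeNormedField]; exact ENat.LEInfty.out) _ _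

/-- Moving a derivative between fields changes the order of the index lists; thanks to this lemma
they need only be tracked as multisets. -/
theorem iterD_perm {d : ℕ} {l l' : List (Fin d)} (h : l.Perm l') {f : Spacetime d → ℝ}
    (hf : ContDiff ℝ ∞ f) : iterD l f = iterD l' f := by
  induction h with
  | nil => rfl
  | cons μ _ ih => rw [iterD_cons, iterD_cons, ih]
  | swap μ ν l => exact partialD_comm _ _ (contDiff_iterD l hf)
  | trans _ _ h₁ h₂ => exact h₁.trans h₂

theorem partialD_sum_mul {d : ℕ} {κ : Type*} (s : Finset κ) (μ : Fin d) (a : κ → ℝ)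
    {f : κ → Spacetime d → ℝ} (hf : ∀ m, ContDiff ℝ ∞ (f m)) :
    partialD μ (fun x => ∑ m ∈ s, a m * f m x) = fun x => ∑ m ∈ s, a m * partialD μ (f m) x := by
  funext x
  have h : HasFDerivAt (fun x => ∑ m ∈ s, a m * f m x) (∑ m ∈ s, a m • fderiv ℝ (f m) x) x :=
    HasFDerivAt.fun_sum fun m _ =>
      (((hf m).differentiable (by simp)) x).hasFDerivAt.const_mul (a m)
  unfold partialD
  rw [h.fderiv]
  simp

theorem iterD_sum_mul {d : ℕ} {κ : Type*} (s : Finset κ) (l : List (Fin d)) (a : κ → ℝ)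
    {f : κ → Spacetime d → ℝ} (hf : ∀ m, ContDiff ℝ ∞ (f m)) :
    iterD l (fun x => ∑ m ∈ s, a m * f m x) = fun x => ∑ m ∈ s, a m * iterD l (f m) x := by
  induction l with
  | nil => rfl
  | cons μ l ih =>
    rw [iterD_cons, ih, partialD_sum_mul s μ a fun m => contDiff_iterD l (hf m)]
    rfl

/-- Allows the value of a field at a point to be adjusted without affecting any differentiated
factor. -/
theorem iterD_const_add {d : ℕ} {l : List (Fin d)} (hl : l ≠ []) (c : ℝ) (f : Spacetime d → ℝ) :
    iterD l (fun x => c + f x) = iterD l f := by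
  induction l with
  | nil => exact absurd rfl hl
  | cons μ l ih =>
    rcases eq_or_ne l [] with rfl | h
    · funext x
      simp [iterD, partialD, fderiv_const_add]
    · rw [iterD_cons, ih h, iterD_cons]

theorem Config.contDiff_component {d n : ℕ} (φ : Config d n) (i : Fin n) :
    ContDiff ℝ ∞ (φ.component i) :=
  contDiff_pi.1 φ.2 i

/-! ### Contractions of coefficient families -/

namespace Contraction

variable {N k : ℕ}

theorem coe_indicesAt {d : ℕ} (Γ : Contraction N k) (μ ν : Fin k → Fin d) (j : Fin N) :
    (Γ.indicesAt μ ν j : Multiset (Fin d)) =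
      ∑ e, ((if Γ.src e = j then {μ e} else 0) + (if Γ.tgt e = j then {ν e} else 0)) := by
  have key : ∀ l : List (Fin k), ((l.flatMap fun e =>
      (if Γ.src e = j then [μ e] else []) ++ (if Γ.tgt e = j then [ν e] else []) :
        List (Fin d)) : Multiset (Fin d)) = (l.map fun e =>
      ((if Γ.src e = j then ({μ e} : Multiset (Fin d)) else 0) +
        (if Γ.tgt e = j then {ν e} else 0))).sum := by
    intro l
    induction l with
    | nil => rfl
    | cons e l ih =>
      rw [List.flatMap_cons, ← Multiset.coe_add, ih, List.map_cons, List.sum_cons,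
        ← Multiset.coe_add]
      congr 2 <;> split_ifs <;> rfl
  rw [indicesAt, key, ← List.sum_ofFn, List.ofFn_eq_map]

theorem length_indicesAt {d : ℕ} (Γ : Contraction N k) (μ ν : Fin k → Fin d) (j : Fin N) :
    (Γ.indicesAt μ ν j).length = Γ.numDerivs j := by
  rw [← Multiset.coe_card, coe_indicesAt, Multiset.card_sum, numDerivs, Finset.card_filter,
    Finset.card_filter, ← Finset.sum_add_distrib]
  refine Finset.sum_congr rfl fun e _ => ?_
  rw [Multiset.card_add]
  congr 1 <;> split_ifs <;> rfl

/-- Without boxes a pair contributes at most one derivative to a given field. -/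
theorem BoxFree.numDerivs_le {Γ : Contraction N k} (h : Γ.BoxFree) (j : Fin N) :
    Γ.numDerivs j ≤ k := by
  rw [numDerivs, ← Finset.card_union_of_disjoint]
  · exact (Finset.card_le_univ _).trans (by simp)
  · rw [Finset.disjoint_filter]
    exact fun e _ h₁ h₂ => h e (h₁.trans h₂.symm)

/-- The contraction of coefficients `c_j(l)`, which stand for the derivative of the `j`-th field
along the list of indices `l`. -/
def contractCoeffs {d : ℕ} (Γ : Contraction N k) (c : Fin N → List (Fin d) → ℝ) : ℝ :=
  ∑ μ : Fin k → Fin d, ∑ ν : Fin k → Fin d,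
    (∏ e, (minkowski d)⁻¹ (μ e) (ν e)) * ∏ j, c j (Γ.indicesAt μ ν j)

/-- The contraction of flavoured coefficients `c_j^i(l)` with a flavour tensor. -/
def termCoeffs {d n : ℕ} (Γ : Contraction N k)
    (t : ContinuousMultilinearMap ℝ (fun _ : Fin N => FieldSpace n) ℝ)
    (c : Fin N → Fin n → List (Fin d) → ℝ) : ℝ :=
  ∑ i : Fin N → Fin n, t (fun j => Pi.single (i j) 1) * Γ.contractCoeffs fun j => c j (i j)

theorem term_eq_termCoeffs {d n : ℕ} (Γ : Contraction N k)
    (t : FieldSpace n → ContinuousMultilinearMap ℝ (fun _ : Fin N => FieldSpace n) ℝ)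
    (φ : Config d n) (x : Spacetime d) :
    Γ.term d t φ x = Γ.termCoeffs (t (φ.1 x)) fun _ i l => iterD l (φ.component i) x := rfl

/-- Coefficients matter only on the lists that occur in the pattern. This matters for jet
coordinates, known only up to order `r`, and for constants, which only nonempty lists annihilate. -/
theorem contractCoeffs_congr {d : ℕ} (Γ : Contraction N k) {c c' : Fin N → List (Fin d) → ℝ}
    (h : ∀ j μ ν, c j (Γ.indicesAt μ ν j) = c' j (Γ.indicesAt μ ν j)) :
    Γ.contractCoeffs c = Γ.contractCoeffs c' := by
  simp only [contractCoeffs, h]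

theorem termCoeffs_congr {d n : ℕ} (Γ : Contraction N k)
    (t : ContinuousMultilinearMap ℝ (fun _ : Fin N => FieldSpace n) ℝ)
    {c c' : Fin N → Fin n → List (Fin d) → ℝ}
    (h : ∀ j i μ ν, c j i (Γ.indicesAt μ ν j) = c' j i (Γ.indicesAt μ ν j)) :
    Γ.termCoeffs t c = Γ.termCoeffs t c' :=
  Finset.sum_congr rfl fun _ _ => by
    rw [Γ.contractCoeffs_congr fun j μ ν => h j _ μ ν]

theorem contractCoeffs_sum_mul {d : ℕ} {κ : Type*} [Fintype κ] (Γ : Contraction N k)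
    (a : Fin N → κ → ℝ) (f : Fin N → κ → List (Fin d) → ℝ) :
    Γ.contractCoeffs (fun j l => ∑ m, a j m * f j m l) =
      ∑ J : Fin N → κ, (∏ j, a j (J j)) * Γ.contractCoeffs fun j => f j (J j) := by
  simp only [contractCoeffs, Fintype.prod_sum, Finset.prod_mul_distrib, Finset.mul_sum]
  refine Eq.trans ?_ Finset.sum_comm
  refine Finset.sum_congr rfl fun _ _ => ?_
  rw [Finset.sum_comm]
  exact Finset.sum_congr rfl fun _ _ => Finset.sum_congr rfl fun _ _ => by ring

theorem map_sum_smul_single {n : ℕ}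
    (t : ContinuousMultilinearMap ℝ (fun _ : Fin N => FieldSpace n) ℝ)
    (v : Fin N → FieldSpace n) :
    t v = ∑ i : Fin N → Fin n, (∏ j, v j (i j)) * t fun j => Pi.single (i j) 1 := by
  have h : v = fun j => ∑ i, v j i • (Pi.single i 1 : FieldSpace n) := by
    funext j
    exact pi_eq_sum_univ' (v j)
  conv_lhs => rw [h, t.map_sum]
  refine Finset.sum_congr rfl fun i _ => ?_
  rw [t.map_smul_univ (fun j => v j (i j)) fun j => Pi.single (i j) 1, smul_eq_mul]

/-- Multilinear expansion that transfers vectors from the coefficients to the tensor. It serves both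
for flavour transformations, with `v` the images of the basis vectors, and for test configurations
`∑ f_m v_m`. -/
theorem termCoeffs_sum_mul {d n : ℕ} {κ : Type*} [Fintype κ] (Γ : Contraction N k)
    (t : ContinuousMultilinearMap ℝ (fun _ : Fin N => FieldSpace n) ℝ)
    (v : κ → FieldSpace n) (f : Fin N → κ → List (Fin d) → ℝ)
    {c : Fin N → Fin n → List (Fin d) → ℝ}
    (hc : ∀ j i μ ν, c j i (Γ.indicesAt μ ν j) = ∑ m, v m i * f j m (Γ.indicesAt μ ν j)) :
    Γ.termCoeffs t c =
      ∑ J : Fin N → κ, t (fun j => v (J j)) * Γ.contractCoeffs fun j => f j (J j) := by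
  rw [Γ.termCoeffs_congr t (c' := fun j i l => ∑ m, v m i * f j m l) hc, termCoeffs]
  have h : ∀ i : Fin N → Fin n, Γ.contractCoeffs (fun j l => ∑ m, v m (i j) * f j m l) =
      ∑ J : Fin N → κ, (∏ j, v (J j) (i j)) * Γ.contractCoeffs fun j => f j (J j) :=
    fun i => Γ.contractCoeffs_sum_mul (fun j m => v m (i j)) f
  simp only [h, Finset.mul_sum]
  rw [Finset.sum_comm]
  refine Finset.sum_congr rfl fun J _ => ?_
  rw [map_sum_smul_single t fun j => v (J j), Finset.sum_mul]
  exact Finset.sum_congr rfl fun _ _ => by ring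

end Contraction

/-! ### Integration by parts -/

namespace Contraction

variable {N k : ℕ}

/-- Move the second derivative of the pair `e` to the field `j`. -/
def retarget (Γ : Contraction N k) (e : Fin k) (j : Fin N) : Contraction N k :=
  ⟨Γ.src, Function.update Γ.tgt e j⟩

/-- Move the second derivative of the pair `e` to a new field, in position `0`. -/
def detach (Γ : Contraction N k) (e : Fin k) : Contraction (N + 1) k :=
  ⟨fun e' => (Γ.src e').succ, Function.update (fun e' => (Γ.tgt e').succ) e 0⟩

theorem detach_indicesAt_zero {d : ℕ} (Γ : Contraction N k) (e : Fin k) (μ ν : Fin k → Fin d) :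
    (Γ.detach e).indicesAt μ ν 0 = [ν e] := by
  rw [← Multiset.coe_eq_singleton, coe_indicesAt, Finset.sum_eq_single e]
  · simp [detach]
  · intro e' _ h
    simp [detach, Function.update_of_ne h]
  · simp

/-- The detached pattern, away from its new field, describes the current before differentiation: the
second end of `e` is missing. Retargeting puts `ν e` back on one field, which is one summand of the
Leibniz rule. -/
theorem retarget_indicesAt_perm {d : ℕ} (Γ : Contraction N k) (e : Fin k) (j' : Fin N)
    (μ ν : Fin k → Fin d) (j : Fin N) :
    ((Γ.retarget e j').indicesAt μ ν j).Perm
      (if j = j' then ν e :: (Γ.detach e).indicesAt μ ν j.succ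
        else (Γ.detach e).indicesAt μ ν j.succ) := by
  rw [← Multiset.coe_eq_coe]
  have h : (((if j = j' then ν e :: (Γ.detach e).indicesAt μ ν j.succ
        else (Γ.detach e).indicesAt μ ν j.succ : List (Fin d))) : Multiset (Fin d)) =
      (if j = j' then {ν e} else 0) + ((Γ.detach e).indicesAt μ ν j.succ : Multiset (Fin d)) := by
    split_ifs
    · rfl
    · rw [zero_add]
  rw [h, coe_indicesAt, coe_indicesAt, ← Finset.add_sum_erase _ _ (Finset.mem_univ e),
    ← Finset.add_sum_erase _ _ (Finset.mem_univ e)]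
  have h' : ∀ e' ∈ Finset.univ.erase e,
      (((if (Γ.retarget e j').src e' = j then {μ e'} else 0) +
        (if (Γ.retarget e j').tgt e' = j then {ν e'} else 0) : Multiset (Fin d))) =
      (if (Γ.detach e).src e' = j.succ then {μ e'} else 0) +
        (if (Γ.detach e).tgt e' = j.succ then {ν e'} else 0) := by
    intro e' he'
    have h₁ : (Γ.detach e).tgt e' = (Γ.tgt e').succ := by
      simp [detach, Function.update_of_ne (Finset.ne_of_mem_erase he')]
    have h₂ : (Γ.retarget e j').tgt e' = Γ.tgt e' := by
      simp [retarget, Function.update_of_ne (Finset.ne_of_mem_erase he')]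
    have h₃ : (Γ.detach e).src e' = (Γ.src e').succ := rfl
    have h₄ : (Γ.retarget e j').src e' = Γ.src e' := rfl
    simp only [h₁, h₂, h₃, h₄, Fin.succ_inj]
  rw [Finset.sum_congr rfl h', ← add_assoc, ← add_assoc]
  congr 1
  simp [retarget, detach, Fin.succ_inj, eq_comm, add_comm, Fin.succ_ne_zero]

/-- The number of contracted pairs of derivatives that act on one and the same field. -/
def numBoxes (Γ : Contraction N k) : ℕ := (Finset.univ.filter fun e => Γ.src e = Γ.tgt e).card

theorem boxFree_of_numBoxes_eq_zero {Γ : Contraction N k} (h : Γ.numBoxes = 0) : Γ.BoxFree := by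
  intro e he
  rw [numBoxes, Finset.card_eq_zero, Finset.filter_eq_empty_iff] at h
  exact h (Finset.mem_univ e) he

/-- Only the pair `e` is altered, and it stops being a box. -/
theorem numBoxes_retarget_lt {Γ : Contraction N k} {e : Fin k} (he : Γ.src e = Γ.tgt e)
    {j : Fin N} (hj : j ≠ Γ.tgt e) : (Γ.retarget e j).numBoxes < Γ.numBoxes := by
  refine Finset.card_lt_card (Finset.ssubset_iff_of_subset ?_ |>.2 ⟨e, ?_, ?_⟩)
  · intro e'
    rw [Finset.mem_filter, Finset.mem_filter]
    rcases eq_or_ne e' e with rfl | h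
    · simp [he]
    · simp [retarget, Function.update_of_ne h]
  · simpa using he
  · rw [Finset.mem_filter]
    simpa [retarget, he] using hj.symm

theorem numBoxes_detach_lt {Γ : Contraction N k} {e : Fin k} (he : Γ.src e = Γ.tgt e) :
    (Γ.detach e).numBoxes < Γ.numBoxes := by
  refine Finset.card_lt_card (Finset.ssubset_iff_of_subset ?_ |>.2 ⟨e, ?_, ?_⟩)
  · intro e'
    rw [Finset.mem_filter, Finset.mem_filter]
    rcases eq_or_ne e' e with rfl | h
    · simp [he]
    · simp [detach, Function.update_of_ne h, Fin.succ_inj]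
  · simpa using he
  · rw [Finset.mem_filter]
    simp [detach, Fin.succ_ne_zero]

theorem retarget_self {Γ : Contraction N k} (e : Fin k) : Γ.retarget e (Γ.tgt e) = Γ := by
  simp [retarget]

end Contraction

/-- The derivative of a flavour tensor, as a flavour tensor with one more index. -/
def tensorDeriv {n N : ℕ}
    (t : FieldSpace n → ContinuousMultilinearMap ℝ (fun _ : Fin N => FieldSpace n) ℝ)
    (u : FieldSpace n) : ContinuousMultilinearMap ℝ (fun _ : Fin (N + 1) => FieldSpace n) ℝ :=
  (fderiv ℝ t u).uncurryLeft

theorem tensorDeriv_apply {n N : ℕ}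
    (t : FieldSpace n → ContinuousMultilinearMap ℝ (fun _ : Fin N => FieldSpace n) ℝ)
    (u : FieldSpace n) (v : Fin (N + 1) → FieldSpace n) :
    tensorDeriv t u v = fderiv ℝ t u (v 0) (Fin.tail v) := rfl

theorem contDiff_tensorDeriv {n N : ℕ}
    {t : FieldSpace n → ContinuousMultilinearMap ℝ (fun _ : Fin N => FieldSpace n) ℝ}
    (ht : ContDiff ℝ ∞ t) : ContDiff ℝ ∞ (tensorDeriv t) := by
  let e := (continuousMultilinearCurryLeftEquiv ℝ (fun _ : Fin (N + 1) => FieldSpace n) ℝ).symm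
  exact e.contDiff.comp (ht.fderiv_right (m := ∞) (by simp))

/-- The summands are kept as full products with a case distinction, so that they match
`retarget_indicesAt_perm` factor by factor. -/
theorem partialD_mul_prod {d N : ℕ} (μ : Fin d) {A : Spacetime d → ℝ} (hA : ContDiff ℝ ∞ A)
    {f : Fin N → Spacetime d → ℝ} (hf : ∀ j, ContDiff ℝ ∞ (f j)) (x : Spacetime d) :
    partialD μ (fun x => A x * ∏ j, f j x) x = partialD μ A x * ∏ j, f j x +
      A x * ∑ j', ∏ j, if j = j' then partialD μ (f j) x else f j x := by
  have h₁ := (hA.differentiable (by simp) x).hasFDerivAt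
  have h₂ : HasFDerivAt (fun x => ∏ j, f j x)
      (∑ j, (∏ i ∈ Finset.univ.erase j, f i x) • fderiv ℝ (f j) x) x :=
    HasFDerivAt.finsetProd fun j _ => ((hf j).differentiable (by simp) x).hasFDerivAt
  have h₃ : ∀ j', (∏ j, if j = j' then partialD μ (f j) x else f j x) =
      (∏ j ∈ Finset.univ.erase j', f j x) * partialD μ (f j') x := by
    intro j'
    rw [← Finset.prod_erase_mul _ _ (Finset.mem_univ j'), if_pos rfl]
    congr 1
    exact Finset.prod_congr rfl fun j hj => if_neg (Finset.ne_of_mem_erase hj)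
  simp only [h₃]
  unfold partialD
  rw [(h₁.fun_mul h₂).fderiv]
  simp [add_comm, mul_comm]

theorem partialD_tensor {d n N : ℕ}
    {t : FieldSpace n → ContinuousMultilinearMap ℝ (fun _ : Fin N => FieldSpace n) ℝ}
    (ht : ContDiff ℝ ∞ t) (φ : Config d n) (ρ : Fin d) (v : Fin N → FieldSpace n)
    (x : Spacetime d) :
    partialD ρ (fun y => t (φ.1 y) v) x =
      ∑ i, fderiv ℝ t (φ.1 x) (Pi.single i 1) v * partialD ρ (φ.component i) x := by
  have h₁ := (φ.2.differentiable (by simp) x).hasFDerivAt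
  have h₂ := (ht.differentiable (by simp) (φ.1 x)).hasFDerivAt
  have h₃ := (h₂.comp x h₁).continuousMultilinear_apply_const v
  have h₄ : ∀ i, partialD ρ (φ.component i) x = fderiv ℝ φ.1 x (basisVec ρ) i := by
    intro i
    have h : HasFDerivAt (φ.component i) _ x := hasFDerivAt_pi'.1 h₁ i
    unfold partialD
    rw [h.fderiv]
    rfl
  simp only [h₄]
  unfold partialD
  have h₅ : fderiv ℝ (fun y => t (φ.1 y) v) x (basisVec ρ) =
      fderiv ℝ t (φ.1 x) (fderiv ℝ φ.1 x (basisVec ρ)) v := by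
    rw [HasFDerivAt.fderiv (f := fun y => t (φ.1 y) v) h₃]
    rfl
  rw [h₅]
  conv_lhs => rw [pi_eq_sum_univ' (fderiv ℝ φ.1 x (basisVec ρ))]
  simp [mul_comm]

namespace Contraction

variable {N k : ℕ}

/-- The current is the term with the second derivative of `e` stripped off. Its divergence hits
either some field `j`, giving `retarget`, or the coefficient `t(φ)`; by the chain rule the latter
creates a new field with one derivative, giving `detach` with `tensorDeriv`. -/
theorem sum_retarget_add_detach_mem {d n : ℕ} (Γ : Contraction N k) (e : Fin k)
    {t : FieldSpace n → ContinuousMultilinearMap ℝ (fun _ : Fin N => FieldSpace n) ℝ}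
    (ht : ContDiff ℝ ∞ t) :
    ∑ j, (Γ.retarget e j).term d t + (Γ.detach e).term d (tensorDeriv t) ∈
      totalDerivatives d n := by
  have key : ∑ j, (Γ.retarget e j).term d t + (Γ.detach e).term d (tensorDeriv t) =
      ∑ i : Fin N → Fin n, ∑ μ : Fin k → Fin d, ∑ ν : Fin k → Fin d,
        (∏ e, (minkowski d)⁻¹ (μ e) (ν e)) • fun (φ : Config d n) => partialD (ν e) fun x =>
          t (φ.1 x) (fun j => Pi.single (i j) 1) *
            ∏ j : Fin N, iterD ((Γ.detach e).indicesAt μ ν j.succ) (φ.component (i j)) x := by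
    funext φ x
    have hA : ∀ v, ContDiff ℝ ∞ fun y => t (φ.1 y) v := fun v =>
      (ContinuousMultilinearMap.apply ℝ (fun _ : Fin N => FieldSpace n) ℝ v).contDiff.comp
        (ht.comp φ.2)
    have h₁ : ∀ (i : Fin N → Fin n) (μ ν : Fin k → Fin d), _ = _ := fun i μ ν =>
      partialD_mul_prod (ν e) (hA fun j => Pi.single (i j) 1)
        (fun j => contDiff_iterD ((Γ.detach e).indicesAt μ ν j.succ)
          (φ.contDiff_component (i j))) x
    have h₂ : ∀ (i : Fin N → Fin n) (μ ν : Fin k → Fin d) (j' : Fin N),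
        (∏ j, if j = j' then partialD (ν e) (iterD ((Γ.detach e).indicesAt μ ν j.succ)
          (φ.component (i j))) x else iterD ((Γ.detach e).indicesAt μ ν j.succ)
          (φ.component (i j)) x) =
        ∏ j, iterD ((Γ.retarget e j').indicesAt μ ν j) (φ.component (i j)) x := by
      intro i μ ν j'
      refine Finset.prod_congr rfl fun j _ => ?_
      rw [iterD_perm (Γ.retarget_indicesAt_perm e j' μ ν j) (φ.contDiff_component (i j))]
      split_ifs <;> rfl
    simp only [Finset.sum_apply, Pi.add_apply, Pi.smul_apply, smul_eq_mul, h₁, h₂,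
      partialD_tensor ht, mul_add, Finset.sum_add_distrib]
    rw [add_comm]
    congr 1
    · simp only [term, contract]
      -- Split off the flavour index of the field created by the chain rule.
      rw [← (Fin.consEquiv fun _ => Fin n).sum_comp, Fintype.sum_prod_type, Finset.sum_comm]
      refine Finset.sum_congr rfl fun i _ => ?_
      simp only [Fin.consEquiv_apply, Fin.prod_univ_succ, detach_indicesAt_zero, Fin.cons_zero,
        Fin.cons_succ, tensorDeriv_apply, Finset.mul_sum, Finset.sum_mul]
      rw [Finset.sum_comm]
      refine Finset.sum_congr rfl fun μ _ => ?_
      rw [Finset.sum_comm]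
      refine Finset.sum_congr rfl fun ν _ => Finset.sum_congr rfl fun i₀ _ => ?_
      have h : iterD [ν e] (φ.component i₀) = partialD (ν e) (φ.component i₀) := rfl
      simp only [Fin.tail_def, Fin.cons_succ, h]
      ring
    · simp only [term, contract, Finset.mul_sum]
      rw [Finset.sum_comm]
      refine Finset.sum_congr rfl fun i _ => ?_
      rw [Finset.sum_comm]
      refine Finset.sum_congr rfl fun μ _ => ?_
      rw [Finset.sum_comm]
      refine Finset.sum_congr rfl fun ν _ => ?_
      exact Finset.sum_congr rfl fun j _ => by ring
  rw [key]
  refine Submodule.sum_mem _ fun i _ => Submodule.sum_mem _ fun μ _ => Submodule.sum_mem _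
    fun ν _ => Submodule.smul_mem _ _ (Submodule.subset_span ⟨ν e, fun φ x =>
      t (φ.1 x) (fun j => Pi.single (i j) 1) *
            ∏ j : Fin N, iterD ((Γ.detach e).indicesAt μ ν j.succ) (φ.component (i j)) x,
      Submodule.subset_span ?_, rfl⟩)
  exact ⟨N, fun u => t u (fun j => Pi.single (i j) 1), i,
    fun j => (Γ.detach e).indicesAt μ ν j.succ,
    (ContinuousMultilinearMap.apply ℝ (fun _ : Fin N => FieldSpace n) ℝ _).contDiff.comp ht, rfl⟩

/-- Induction on the number of boxes. The tensor `t` and the number of fields never change, so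
invariance of the tensor survives the reduction. -/
theorem term_const_mem {d n : ℕ} (Γ : Contraction N k)
    (t : ContinuousMultilinearMap ℝ (fun _ : Fin N => FieldSpace n) ℝ) :
    Γ.term d (fun _ => t) ∈
      Submodule.span ℝ {F | ∃ Γ' : Contraction N k, Γ'.BoxFree ∧ F = Γ'.term d fun _ => t} ⊔
        totalDerivatives d n := by
  induction h : Γ.numBoxes using Nat.strong_induction_on generalizing Γ with
  | _ m ih =>
  subst h
  rcases Nat.eq_zero_or_pos Γ.numBoxes with h₀ | h₀
  · exact Submodule.mem_sup_left
      (Submodule.subset_span ⟨Γ, boxFree_of_numBoxes_eq_zero h₀, rfl⟩)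
  obtain ⟨e, he⟩ := Finset.card_pos.1 h₀
  replace he : Γ.src e = Γ.tgt e := by simpa using he
  have h := Γ.sum_retarget_add_detach_mem (d := d) e (t := fun _ => t) contDiff_const
  -- A constant tensor has no derivative, so no term with an additional field appears.
  have hz : (Γ.detach e).term d (tensorDeriv fun _ : FieldSpace n => t) = 0 := by
    funext φ x
    simp [term, tensorDeriv_apply]
  rw [hz, add_zero, ← Finset.add_sum_erase _ _ (Finset.mem_univ (Γ.tgt e)), retarget_self] at h
  have h' := Submodule.sum_mem _ fun j (hj : j ∈ Finset.univ.erase (Γ.tgt e)) =>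
    ih _ (numBoxes_retarget_lt he (Finset.ne_of_mem_erase hj)) (Γ.retarget e j) rfl
  simpa using Submodule.sub_mem _ (Submodule.mem_sup_right h) h'

end Contraction

/-! ### Box removal with field-dependent covariant tensors -/

/-- Covariance of a field-dependent flavour tensor under the internal symmetry. -/
def TensorInvariant {n N : ℕ} {G : Type*} [Group G] (ρ : Representation ℝ G (FieldSpace n))
    (t : FieldSpace n → ContinuousMultilinearMap ℝ (fun _ : Fin N => FieldSpace n) ℝ) : Prop :=
  ∀ (g : G) (u : FieldSpace n) (v : Fin N → FieldSpace n),
    t (ρ g u) (fun j => ρ g (v j)) = t u v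

/-- Differentiate the covariance identity in `u` with the remaining arguments held fixed; both sides
are derivatives of the same function. -/
theorem TensorInvariant.tensorDeriv {n N : ℕ} {G : Type*} [Group G]
    {ρ : Representation ℝ G (FieldSpace n)}
    {t : FieldSpace n → ContinuousMultilinearMap ℝ (fun _ : Fin N => FieldSpace n) ℝ}
    (ht : ContDiff ℝ ∞ t) (h : TensorInvariant ρ t) : TensorInvariant ρ (tensorDeriv t) := by
  intro g u v
  have hd := fun u => (ht.differentiable (by simp) u).hasFDerivAt
  have h₁ := ((hd (ρ g u)).comp u (flavourMap ρ g).hasFDerivAt).continuousMultilinear_apply_const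
    fun j => ρ g (Fin.tail v j)
  have h₂ := (hd u).continuousMultilinear_apply_const (Fin.tail v)
  have h₃ : (fun y => (t ∘ ρ g) y fun j => ρ g (Fin.tail v j)) =
      fun y => t y (Fin.tail v) := funext fun y => h g y (Fin.tail v)
  rw [h₃] at h₁
  exact congrArg (fun L => L (v 0)) (h₁.unique h₂)

/-- Combinations of box-free terms with `2 k` derivatives whose field-dependent flavour tensors are
covariant. -/
def covariantBoxFree (d : ℕ) {n : ℕ} {G : Type*} [Group G]
    (ρ : Representation ℝ G (FieldSpace n)) (k : ℕ) : Submodule ℝ (Functional d n) :=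
  Submodule.span ℝ {F | ∃ (N : ℕ) (Γ : Contraction N k)
    (t : FieldSpace n → ContinuousMultilinearMap ℝ (fun _ : Fin N => FieldSpace n) ℝ),
      Γ.BoxFree ∧ ContDiff ℝ ∞ t ∧ TensorInvariant ρ t ∧ F = Γ.term d t}

/-- The same induction as for constant tensors, now over varying `N`: the chain-rule term has one
field more but fewer boxes, and its tensor is again covariant. -/
theorem Contraction.term_mem_covariantBoxFree {d n N k : ℕ} {G : Type*} [Group G]
    {ρ : Representation ℝ G (FieldSpace n)} (Γ : Contraction N k)
    {t : FieldSpace n → ContinuousMultilinearMap ℝ (fun _ : Fin N => FieldSpace n) ℝ}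
    (ht : ContDiff ℝ ∞ t) (hρ : TensorInvariant ρ t) :
    Γ.term d t ∈ covariantBoxFree d ρ k ⊔ totalDerivatives d n := by
  induction h : Γ.numBoxes using Nat.strong_induction_on generalizing N with
  | _ m ih =>
  subst h
  rcases Nat.eq_zero_or_pos Γ.numBoxes with h₀ | h₀
  · exact Submodule.mem_sup_left
      (Submodule.subset_span ⟨N, Γ, t, boxFree_of_numBoxes_eq_zero h₀, ht, hρ, rfl⟩)
  obtain ⟨e, he⟩ := Finset.card_pos.1 h₀
  replace he : Γ.src e = Γ.tgt e := by simpa using he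
  have h := Γ.sum_retarget_add_detach_mem (d := d) e ht
  rw [← Finset.add_sum_erase _ _ (Finset.mem_univ (Γ.tgt e)), retarget_self] at h
  have h' := Submodule.sum_mem _ fun j (hj : j ∈ Finset.univ.erase (Γ.tgt e)) =>
    ih _ (numBoxes_retarget_lt he (Finset.ne_of_mem_erase hj)) (Γ.retarget e j) ht hρ rfl
  have h'' := ih _ (numBoxes_detach_lt he) (Γ.detach e) (contDiff_tensorDeriv ht)
    (hρ.tensorDeriv ht) rfl
  have := Submodule.sub_mem _ (Submodule.sub_mem _ (Submodule.mem_sup_right h) h') h''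
  convert! this using 1
  abel

/-! ### Extraction of multilinear coefficients -/

/-- Polarisation. A polynomial vanishing at all real points is zero, and the monomial `y_1 ⋯ y_M`
comes only from `N = M` with `J` a bijection. This isolates one number of fields from a sum over
several. -/
theorem sum_perm_eq_zero_of_sum_eq_zero {M : ℕ} (s : Finset ℕ)
    (a : ∀ N, (Fin N → Fin M) → ℝ)
    (h : ∀ y : Fin M → ℝ, ∑ N ∈ s, ∑ J : Fin N → Fin M, a N J * ∏ j, y (J j) = 0) (hM : M ∈ s) :
    ∑ σ : Equiv.Perm (Fin M), a M σ = 0 := by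
  classical
  let one : Fin M →₀ ℕ := Finsupp.equivFunOnFinite.symm fun _ => 1
  have hP : (∑ N ∈ s, ∑ J : Fin N → Fin M, MvPolynomial.monomial
      (∑ j, Finsupp.single (J j) 1) (a N J)) = 0 := by
    refine MvPolynomial.funext fun y => ?_
    rw [map_zero, ← h y, map_sum]
    refine Finset.sum_congr rfl fun N _ => ?_
    rw [map_sum]
    refine Finset.sum_congr rfl fun J _ => ?_
    rw [MvPolynomial.eval_monomial,
      ← Finsupp.prod_finsetSum_index (by simp) (by simp [pow_add])]
    simp
  have hc := congrArg (MvPolynomial.coeff one) hP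
  simp only [MvPolynomial.coeff_sum, MvPolynomial.coeff_monomial, MvPolynomial.coeff_zero] at hc
  have hdeg : ∀ N (J : Fin N → Fin M), ∑ j, Finsupp.single (J j) 1 = one → N = M := by
    intro N J hJ
    have := congrArg Finsupp.degree hJ
    simpa [Finsupp.degree_eq_sum, one, map_sum] using this
  rw [Finset.sum_eq_single_of_mem M hM fun N _ hN => Finset.sum_eq_zero fun J _ =>
    if_neg fun hJ => hN (hdeg N J hJ)] at hc
  have hbij : ∀ J : Fin M → Fin M, ∑ j, Finsupp.single (J j) 1 = one ↔ J.Bijective := by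
    intro J
    constructor
    · intro hJ
      refine Finite.surjective_iff_bijective.1 fun m => ?_
      by_contra! hm
      have := DFunLike.congr_fun hJ m
      simp [hm, one, Finsupp.finsetSum_apply] at this
    · intro hJ
      ext m
      rw [Finsupp.finsetSum_apply]
      exact ((Equiv.ofBijective J hJ).sum_comp fun m' =>
        (Finsupp.single m' 1 : Fin M →₀ ℕ) m).trans (by simp [one, Finsupp.single_apply])
  rw [← hc, ← Finset.sum_filter]
  symm
  refine Finset.sum_bij' (fun J hJ => Equiv.ofBijective J ((hbij J).1 (Finset.mem_filter.1 hJ).2))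
    (fun σ _ => σ) (by simp) (fun σ _ => Finset.mem_filter.2 ⟨Finset.mem_univ _, (hbij σ).2 σ.bijective⟩) (fun _ _ => rfl)
    (fun σ _ => by ext; rfl) (fun _ _ => rfl)

/-- A finite family of vectors is expanded in itself by coefficients depending linearly on the
vector. -/
theorem exists_linear_coefficients {W Q : Type*} [AddCommGroup W] [Module ℝ W] [Fintype Q]
    (D : Q → W) : ∃ s : W →ₗ[ℝ] (Q → ℝ), ∀ q, D q = ∑ q', s (D q) q' • D q' := by
  classical
  -- A linear section of the map from coefficient vectors onto the span of the family, then extended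
  -- from the span to all of `W`.
  obtain ⟨s, hs⟩ := (Fintype.linearCombination ℝ D).rangeRestrict.exists_rightInverse_of_surjective
    (LinearMap.range_rangeRestrict _)
  obtain ⟨s', hs'⟩ := LinearMap.exists_extend s
  refine ⟨s', fun q => ?_⟩
  have hq : D q ∈ LinearMap.range (Fintype.linearCombination ℝ D) :=
    ⟨Pi.single q 1, by simp⟩
  have h₁ : s' (D q) = s ⟨D q, hq⟩ := DFunLike.congr_fun hs' ⟨D q, hq⟩
  have h₂ := congrArg Subtype.val (DFunLike.congr_fun hs ⟨D q, hq⟩)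
  simp only [LinearMap.comp_apply, LinearMap.id_apply, LinearMap.codRestrict_apply,
    LinearMap.rangeRestrict, Fintype.linearCombination_apply] at h₂
  rw [h₁, h₂]

/-! ### Canonical forms of flavour tensors -/

namespace Contraction

variable {N k : ℕ}

/-- Relabel the fields. -/
def permute (σ : Equiv.Perm (Fin N)) (Γ : Contraction N k) : Contraction N k :=
  ⟨fun e => σ (Γ.src e), fun e => σ (Γ.tgt e)⟩

theorem permute_indicesAt {d : ℕ} (σ : Equiv.Perm (Fin N)) (Γ : Contraction N k)
    (μ ν : Fin k → Fin d) (j : Fin N) :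
    (Γ.permute σ).indicesAt μ ν (σ j) = Γ.indicesAt μ ν j := by
  simp [indicesAt, permute]

theorem permute_numDerivs (σ : Equiv.Perm (Fin N)) (Γ : Contraction N k) (j : Fin N) :
    (Γ.permute σ).numDerivs j = Γ.numDerivs (σ.symm j) := by
  unfold numDerivs
  congr 2 <;> ext e <;> rw [Finset.mem_filter, Finset.mem_filter] <;>
    simp [permute, Equiv.eq_symm_apply]

theorem BoxFree.permute {Γ : Contraction N k} (h : Γ.BoxFree) (σ : Equiv.Perm (Fin N)) :
    (Γ.permute σ).BoxFree := fun e he => h e (σ.injective he)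

theorem contractCoeffs_permute {d : ℕ} (σ : Equiv.Perm (Fin N)) (Γ : Contraction N k)
    (c : Fin N → List (Fin d) → ℝ) :
    (Γ.permute σ).contractCoeffs c = Γ.contractCoeffs fun j => c (σ j) := by
  refine Finset.sum_congr rfl fun μ _ => Finset.sum_congr rfl fun ν _ => ?_
  rw [← Equiv.prod_comp σ]
  simp only [permute_indicesAt]

theorem contract_permute {d : ℕ} (σ : Equiv.Perm (Fin N)) (Γ : Contraction N k)
    (f : Fin N → Spacetime d → ℝ) (x : Spacetime d) :
    (Γ.permute σ).contract f x = Γ.contract (fun j => f (σ j)) x :=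
  Γ.contractCoeffs_permute σ fun j l => iterD l (f j) x

end Contraction

/-- A finite family of contraction patterns for `N` fields, stable under relabelling the fields. -/
structure ContractionFamily (N : ℕ) where
  Index : Type
  [fintype : Fintype Index]
  order : Index → ℕ
  graph : ∀ q, Contraction N (order q)
  perm : Equiv.Perm (Fin N) → Index → Index
  contract_perm : ∀ {d : ℕ} (σ : Equiv.Perm (Fin N)) (q : Index) (f : Fin N → Spacetime d → ℝ)
    (x : Spacetime d), (graph (perm σ q)).contract f x = (graph q).contract (fun j => f (σ j)) x

attribute [instance] ContractionFamily.fintype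

namespace ContractionFamily

variable {N : ℕ}

/-- The contractions as functionals of tuples of smooth functions. -/
def functional (𝒬 : ContractionFamily N) (d : ℕ) (q : 𝒬.Index) :
    (Fin N → {f : Spacetime d → ℝ // ContDiff ℝ ∞ f}) → Spacetime d → ℝ :=
  fun f x => (𝒬.graph q).contract (fun j => (f j).1) x

theorem exists_coefficients (𝒬 : ContractionFamily N) (d : ℕ) :
    ∃ s : ((Fin N → {f : Spacetime d → ℝ // ContDiff ℝ ∞ f}) → Spacetime d → ℝ) →ₗ[ℝ]
      (𝒬.Index → ℝ), ∀ q, 𝒬.functional d q =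
        ∑ q', s (𝒬.functional d q) q' • 𝒬.functional d q' :=
  exists_linear_coefficients _

/-- The coefficients of the contractions in terms of a linearly independent subfamily. -/
def coefficient (𝒬 : ContractionFamily N) (d : ℕ) (q : 𝒬.Index) : 𝒬.Index → ℝ :=
  (𝒬.exists_coefficients d).choose (𝒬.functional d q)

theorem contract_eq_sum_coefficient (𝒬 : ContractionFamily N) {d : ℕ} (q : 𝒬.Index)
    {f : Fin N → Spacetime d → ℝ} (hf : ∀ j, ContDiff ℝ ∞ (f j)) (x : Spacetime d) :
    (𝒬.graph q).contract f x =
      ∑ q', 𝒬.coefficient d q q' * (𝒬.graph q').contract f x := by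
  have h := congrFun (congrFun ((𝒬.exists_coefficients d).choose_spec q) fun j => ⟨f j, hf j⟩) x
  simpa [functional, coefficient] using h

/-- The coefficients are values of one linear map on the contraction functionals, so they inherit
every linear relation between contractions. -/
theorem sum_coefficient_eq_zero (𝒬 : ContractionFamily N) {d : ℕ} {ι : Type*} [Fintype ι]
    (p : ι → 𝒬.Index) (a : ι → ℝ)
    (h : ∀ f : Fin N → Spacetime d → ℝ, (∀ j, ContDiff ℝ ∞ (f j)) → ∀ x,
      ∑ m, a m * (𝒬.graph (p m)).contract f x = 0) (q : 𝒬.Index) :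
    ∑ m, a m * 𝒬.coefficient d (p m) q = 0 := by
  have h₀ : ∑ m, a m • 𝒬.functional d (p m) = 0 := by
    funext f x
    simpa [functional] using h (fun j => (f j).1) (fun j => (f j).2) x
  have h₁ := congrFun (congrArg (𝒬.exists_coefficients d).choose h₀) q
  simpa [coefficient] using h₁

/-- The canonical form of a family of flavour tensors: it is symmetrised under simultaneous
permutations of flavour and spacetime labels, and expressed in linearly independent contractions. -/
def canonical (𝒬 : ContractionFamily N) (d : ℕ) {n : ℕ}
    (t : 𝒬.Index → ContinuousMultilinearMap ℝ (fun _ : Fin N => FieldSpace n) ℝ) (q : 𝒬.Index) :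
    ContinuousMultilinearMap ℝ (fun _ : Fin N => FieldSpace n) ℝ :=
  (N.factorial : ℝ)⁻¹ • ∑ p : Equiv.Perm (Fin N) × 𝒬.Index,
    𝒬.coefficient d (𝒬.perm p.1 p.2) q • (t p.2).domDomCongr p.1

theorem canonical_apply (𝒬 : ContractionFamily N) (d : ℕ) {n : ℕ}
    (t : 𝒬.Index → ContinuousMultilinearMap ℝ (fun _ : Fin N => FieldSpace n) ℝ) (q : 𝒬.Index)
    (v : Fin N → FieldSpace n) :
    𝒬.canonical d t q v = (N.factorial : ℝ)⁻¹ * ∑ p : Equiv.Perm (Fin N) × 𝒬.Index,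
      𝒬.coefficient d (𝒬.perm p.1 p.2) q * t p.2 (fun j => v (p.1 j)) := by
  simp [canonical]

theorem contDiff_canonical (𝒬 : ContractionFamily N) (d : ℕ) {n : ℕ}
    {t : 𝒬.Index → FieldSpace n →
      ContinuousMultilinearMap ℝ (fun _ : Fin N => FieldSpace n) ℝ}
    (ht : ∀ q, ContDiff ℝ ∞ (t q)) (q : 𝒬.Index) :
    ContDiff ℝ ∞ fun u => 𝒬.canonical d (fun q' => t q' u) q := by
  refine ContDiff.const_smul _ (ContDiff.sum fun p _ => ContDiff.const_smul _ ?_)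
  exact (ContinuousMultilinearMap.domDomCongrₗᵢ ℝ (FieldSpace n) ℝ p.1).contDiff.comp (ht p.2)

/-- Expanding the contractions in one another changes nothing, and permuting the fields only
reorders the sum over flavour indices. The `N!` equal copies cancel the prefactor. -/
theorem sum_termCoeffs_canonical (𝒬 : ContractionFamily N) {d n : ℕ}
    (t : 𝒬.Index → ContinuousMultilinearMap ℝ (fun _ : Fin N => FieldSpace n) ℝ)
    (φ : Config d n) (x : Spacetime d) :
    ∑ q, (𝒬.graph q).termCoeffs (𝒬.canonical d t q) (fun _ i l => iterD l (φ.component i) x) =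
      ∑ q, (𝒬.graph q).termCoeffs (t q) fun _ i l => iterD l (φ.component i) x := by
  have hc : ∀ (q : 𝒬.Index) (i : Fin N → Fin n), (𝒬.graph q).contractCoeffs
      (fun j l => iterD l (φ.component (i j)) x) =
        (𝒬.graph q).contract (fun j => φ.component (i j)) x := fun _ _ => rfl
  have h : ∀ i : Fin N → Fin n, ∑ q, 𝒬.canonical d t q (fun j => Pi.single (i j) 1) *
      (𝒬.graph q).contract (fun j => φ.component (i j)) x =
      (N.factorial : ℝ)⁻¹ * ∑ p : Equiv.Perm (Fin N) × 𝒬.Index,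
        t p.2 (fun j => Pi.single (i (p.1 j)) 1) *
          (𝒬.graph p.2).contract (fun j => φ.component (i (p.1 j))) x := by
    intro i
    have h₁ : ∀ p : Equiv.Perm (Fin N) × 𝒬.Index,
        (𝒬.graph p.2).contract (fun j => φ.component (i (p.1 j))) x =
        ∑ q, 𝒬.coefficient d (𝒬.perm p.1 p.2) q *
          (𝒬.graph q).contract (fun j => φ.component (i j)) x := fun p => by
      rw [← 𝒬.contract_eq_sum_coefficient _ fun j => φ.contDiff_component (i j),
        𝒬.contract_perm p.1 p.2 fun j => φ.component (i j)]
    simp only [canonical_apply, h₁, Finset.mul_sum, Finset.sum_mul]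
    rw [Finset.sum_comm]
    exact Finset.sum_congr rfl fun _ _ => Finset.sum_congr rfl fun _ _ => by ring
  simp only [Contraction.termCoeffs, hc]
  rw [Finset.sum_comm]
  simp only [h]
  rw [← Finset.mul_sum, Finset.sum_comm, Fintype.sum_prod_type]
  have h₂ : ∀ (σ : Equiv.Perm (Fin N)) (q : 𝒬.Index), ∑ i : Fin N → Fin n,
      t q (fun j => Pi.single (i (σ j)) 1) *
        (𝒬.graph q).contract (fun j => φ.component (i (σ j))) x =
      ∑ i : Fin N → Fin n, t q (fun j => Pi.single (i j) 1) *
        (𝒬.graph q).contract (fun j => φ.component (i j)) x := fun σ q =>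
    (σ.arrowCongr (Equiv.refl (Fin n))).symm.sum_comp fun i : Fin N → Fin n =>
      t q (fun j => Pi.single (i j) 1) * (𝒬.graph q).contract (fun j => φ.component (i j)) x
  simp only [h₂, Finset.sum_const, Finset.card_univ, Fintype.card_perm, Fintype.card_fin,
    nsmul_eq_mul]
  rw [inv_mul_cancel_left₀ (by positivity), Finset.sum_comm]

/-- The hypothesis is the polarised form of a vanishing Lagrangian. For fixed `v` it is a linear
relation between permuted contractions, which `sum_coefficient_eq_zero` turns into the vanishing of
the canonical tensor at `v`. -/
theorem canonical_eq_zero (𝒬 : ContractionFamily N) {d n : ℕ}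
    (t : 𝒬.Index → ContinuousMultilinearMap ℝ (fun _ : Fin N => FieldSpace n) ℝ)
    (h : ∀ (v : Fin N → FieldSpace n) (f : Fin N → Spacetime d → ℝ),
      (∀ j, ContDiff ℝ ∞ (f j)) → ∀ x, ∑ σ : Equiv.Perm (Fin N), ∑ q,
        t q (fun j => v (σ j)) * (𝒬.graph q).contract (fun j => f (σ j)) x = 0) (q : 𝒬.Index) :
    𝒬.canonical d t q = 0 := by
  ext v
  rw [canonical_apply]
  have := 𝒬.sum_coefficient_eq_zero (d := d) (ι := Equiv.Perm (Fin N) × 𝒬.Index)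
    (fun p => 𝒬.perm p.1 p.2) (fun p => t p.2 fun j => v (p.1 j)) (fun f hf x => by
      rw [Fintype.sum_prod_type, ← h v f hf x]
      simp only [𝒬.contract_perm]) q
  simp only [mul_comm (𝒬.coefficient d _ q), this]
  simp

/-- Flavour maps act on the tensor arguments, while the construction touches only field labels and
contraction coefficients. -/
theorem canonical_sub_compContinuousLinearMap (𝒬 : ContractionFamily N) (d : ℕ) {n : ℕ}
    (t t' : 𝒬.Index → ContinuousMultilinearMap ℝ (fun _ : Fin N => FieldSpace n) ℝ)
    (T : FieldSpace n →L[ℝ] FieldSpace n) (q : 𝒬.Index) :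
    𝒬.canonical d (fun q => (t q).compContinuousLinearMap (fun _ => T) - t' q) q =
      (𝒬.canonical d t q).compContinuousLinearMap (fun _ => T) - 𝒬.canonical d t' q := by
  ext v
  simp [canonical_apply, mul_sub]

end ContractionFamily

/-! ### Covariant flavour tensors -/

namespace Contraction

variable {N k : ℕ}

theorem indicesAt_ne_nil {d : ℕ} {Γ : Contraction N k} {j : Fin N}
    (h : 0 < Γ.numDerivs j) (μ ν : Fin k → Fin d) : Γ.indicesAt μ ν j ≠ [] := by
  rw [← List.length_pos_iff, length_indicesAt]
  exact h

/-- The constant `u` drops out when every field is differentiated, so the expansion involves only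
the test functions `f m`. -/
theorem termCoeffs_affine {d n : ℕ} {κ : Type*} [Fintype κ] (Γ : Contraction N k)
    (t : ContinuousMultilinearMap ℝ (fun _ : Fin N => FieldSpace n) ℝ)
    (φ : Config d n) (u : FieldSpace n) (v : κ → FieldSpace n) {f : κ → Spacetime d → ℝ}
    (hf : ∀ m, ContDiff ℝ ∞ (f m)) (hφ : ∀ x, φ.1 x = u + ∑ m, f m x • v m)
    (h : (∀ j, 0 < Γ.numDerivs j) ∨ u = 0) (x : Spacetime d) :
    Γ.termCoeffs t (fun _ i l => iterD l (φ.component i) x) =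
      ∑ J : Fin N → κ, t (fun j => v (J j)) * Γ.contract (fun j => f (J j)) x := by
  refine Γ.termCoeffs_sum_mul t v (fun _ m l => iterD l (f m) x) fun j i μ ν => ?_
  have h₁ : φ.component i = fun x => u i + ∑ m, v m i * f m x := by
    funext x
    simp [Config.component, hφ, mul_comm]
  rw [h₁]
  rcases h with h | rfl
  · rw [iterD_const_add (indicesAt_ne_nil (h j) μ ν),
      iterD_sum_mul _ _ _ hf]
  · simp only [Pi.zero_apply, zero_add]
    rw [iterD_sum_mul _ _ _ hf]

theorem termCoeffs_transform {d n : ℕ} {G : Type*} [Group G]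
    (ρ : Representation ℝ G (FieldSpace n)) (g : G) (Γ : Contraction N k)
    (t : ContinuousMultilinearMap ℝ (fun _ : Fin N => FieldSpace n) ℝ)
    (φ : Config d n) (x : Spacetime d) :
    Γ.termCoeffs t (fun _ i l => iterD l ((φ.transform ρ g).component i) x) =
      Γ.termCoeffs (t.compContinuousLinearMap fun _ => flavourMap ρ g)
        fun _ i l => iterD l (φ.component i) x := by
  refine Γ.termCoeffs_affine t _ 0 (fun i => flavourMap ρ g (Pi.single i 1))
    (f := φ.component) φ.contDiff_component (fun x => ?_) (Or.inr rfl) x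
  rw [zero_add]
  change flavourMap ρ g (φ.1 x) = _
  conv_lhs => rw [pi_eq_sum_univ' (φ.1 x), map_sum]
  simp only [map_smul]
  rfl

theorem term_isInvariant {d n : ℕ} {G : Type*} [Group G]
    {ρ : Representation ℝ G (FieldSpace n)} (Γ : Contraction N k)
    {t : FieldSpace n → ContinuousMultilinearMap ℝ (fun _ : Fin N => FieldSpace n) ℝ}
    (ht : TensorInvariant ρ t) : Functional.IsInvariant ρ (Γ.term d t) := by
  intro g φ
  funext x
  rw [term_eq_termCoeffs, term_eq_termCoeffs, termCoeffs_transform]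
  congr 1
  ext v
  exact ht g (φ.1 x) v

instance : Finite (Contraction N k) :=
  Finite.of_injective (fun Γ : Contraction N k => (Γ.src, Γ.tgt)) fun Γ Γ' h => by
    cases Γ
    cases Γ'
    simpa using h

instance : Fintype (Contraction N k) := Fintype.ofFinite _

theorem sum_numDerivs (Γ : Contraction N k) : ∑ j, Γ.numDerivs j = 2 * k := by
  simp only [numDerivs, Finset.card_filter, Finset.sum_add_distrib]
  rw [Finset.sum_comm]
  conv_lhs => enter [2]; rw [Finset.sum_comm]
  simp [two_mul]

/-- Insert a field without derivatives in position `j`. -/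
def insertBare (Γ : Contraction N k) (j : Fin (N + 1)) : Contraction (N + 1) k :=
  ⟨fun e => j.succAbove (Γ.src e), fun e => j.succAbove (Γ.tgt e)⟩

theorem exists_eq_insertBare {Γ : Contraction (N + 1) k} {j : Fin (N + 1)}
    (h : Γ.numDerivs j = 0) : ∃ Γ' : Contraction N k, Γ = Γ'.insertBare j := by
  rw [numDerivs, Nat.add_eq_zero_iff, Finset.card_eq_zero, Finset.card_eq_zero,
    Finset.filter_eq_empty_iff, Finset.filter_eq_empty_iff] at h
  choose s hs using fun e => Fin.exists_succAbove_eq (h.1 (Finset.mem_univ e))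
  choose s' hs' using fun e => Fin.exists_succAbove_eq (h.2 (Finset.mem_univ e))
  refine ⟨⟨s, s'⟩, ?_⟩
  cases Γ
  simp only [insertBare, mk.injEq]
  exact ⟨funext fun e => (hs e).symm, funext fun e => (hs' e).symm⟩

theorem BoxFree.of_insertBare {Γ : Contraction N k} {j : Fin (N + 1)}
    (h : (Γ.insertBare j).BoxFree) : Γ.BoxFree :=
  fun e he => h e (congrArg j.succAbove he)

theorem insertBare_indicesAt_self {d : ℕ} (Γ : Contraction N k) (j : Fin (N + 1))
    (μ ν : Fin k → Fin d) : (Γ.insertBare j).indicesAt μ ν j = [] := by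
  simp [indicesAt, insertBare, Fin.succAbove_ne]

theorem insertBare_indicesAt_succAbove {d : ℕ} (Γ : Contraction N k) (j : Fin (N + 1))
    (μ ν : Fin k → Fin d) (j' : Fin N) :
    (Γ.insertBare j).indicesAt μ ν (j.succAbove j') = Γ.indicesAt μ ν j' := by
  simp [indicesAt, insertBare]

/-- An undifferentiated field is a function of `φ` and can be absorbed in the coefficient by
evaluating the tensor at `φ` in that slot. -/
theorem term_insertBare {d n : ℕ} (Γ : Contraction N k) (j : Fin (N + 1))
    (t : FieldSpace n → ContinuousMultilinearMap ℝ (fun _ : Fin (N + 1) => FieldSpace n) ℝ) :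
    (Γ.insertBare j).term d t = Γ.term d fun u => (t u).curryMid j u := by
  funext φ x
  simp only [term, contract]
  rw [← (Fin.insertNthEquiv (fun _ => Fin n) j).sum_comp, Fintype.sum_prod_type, Finset.sum_comm]
  refine Finset.sum_congr rfl fun i _ => ?_
  have h₁ : (t (φ.1 x)).curryMid j (φ.1 x) (fun j' => Pi.single (i j') 1) =
      ∑ i₀, φ.1 x i₀ * (t (φ.1 x)).curryMid j (Pi.single i₀ 1) fun j' => Pi.single (i j') 1 := by
    conv_lhs => enter [1, 2]; rw [pi_eq_sum_univ' (φ.1 x)]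
    simp
  rw [h₁, Finset.sum_mul]
  refine Finset.sum_congr rfl fun i₀ _ => ?_
  simp only [Fin.insertNthEquiv_apply, Fin.prod_univ_succAbove _ j, insertBare_indicesAt_self,
    insertBare_indicesAt_succAbove, Fin.insertNth_apply_same, Fin.insertNth_apply_succAbove,
    ContinuousMultilinearMap.curryMid_apply]
  have h₂ : (fun j' : Fin (N + 1) => (Pi.single (j.insertNth (α := fun _ => Fin n) i₀ i j') 1 :
      FieldSpace n)) = j.insertNth (Pi.single i₀ 1) fun j' => Pi.single (i j') 1 := by
    funext j'
    rcases Fin.eq_self_or_eq_succAbove j j' with rfl | ⟨j', rfl⟩ <;> simp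
  have h₃ : iterD [] (φ.component i₀) x = φ.1 x i₀ := rfl
  simp only [h₂, h₃, Finset.mul_sum]
  exact Finset.sum_congr rfl fun _ _ => Finset.sum_congr rfl fun _ _ => by ring

end Contraction

theorem contDiff_curryMid_self {n N : ℕ} (j : Fin (N + 1))
    {t : FieldSpace n → ContinuousMultilinearMap ℝ (fun _ : Fin (N + 1) => FieldSpace n) ℝ}
    (ht : ContDiff ℝ ∞ t) : ContDiff ℝ ∞ fun u => (t u).curryMid j u := by
  let e := ContinuousMultilinearMap.curryMidEquiv ℝ (fun _ : Fin (N + 1) => FieldSpace n) ℝ j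
  exact (e.contDiff.comp ht).clm_apply contDiff_id

/-! ### Covariance of canonical tensors of invariant Lagrangians -/

namespace ContractionFamily

/-- All contraction patterns with `k` pairs of derivatives. -/
def all (N k : ℕ) : ContractionFamily N where
  Index := Contraction N k
  order _ := k
  graph Γ := Γ
  perm σ Γ := Γ.permute σ
  contract_perm σ Γ f x := Γ.contract_permute σ f x

/-- The contraction patterns with at most `r + 1` pairs of derivatives, at least one derivative on
each field, and no boxes if `b` holds. -/
def differentiated (r : ℕ) (b : Prop) (N : ℕ) : ContractionFamily N where
  Index := {q : Σ k : Fin (r + 2), Contraction N k //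
    (∀ j, 0 < q.2.numDerivs j) ∧ (b → q.2.BoxFree)}
  fintype := Fintype.ofFinite _
  order q := q.1.1
  graph q := q.1.2
  perm σ q := ⟨⟨q.1.1, q.1.2.permute σ⟩, fun j => by
    rw [Contraction.permute_numDerivs]; exact q.2.1 _, fun hb => (q.2.2 hb).permute σ⟩
  contract_perm σ q f x := q.1.2.contract_permute σ f x

/-- Rescaling each `v m` by a parameter `y m` makes the hypothesis a polynomial identity in `y`. Its
part multilinear in all `M` parameters is what `canonical_eq_zero` requires. -/
theorem canonical_eq_zero_of_sum_eq_zero {d n M : ℕ} (𝒬 : ∀ N, ContractionFamily N)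
    (s : Finset ℕ)
    (t : ∀ N, (𝒬 N).Index → ContinuousMultilinearMap ℝ (fun _ : Fin N => FieldSpace n) ℝ)
    (h : ∀ (v : Fin M → FieldSpace n) (f : Fin M → Spacetime d → ℝ),
      (∀ m, ContDiff ℝ ∞ (f m)) → ∀ x, ∑ N ∈ s, ∑ q, ∑ J : Fin N → Fin M,
        t N q (fun j => v (J j)) * ((𝒬 N).graph q).contract (fun j => f (J j)) x = 0)
    (hM : M ∈ s) (q : (𝒬 M).Index) : (𝒬 M).canonical d (t M) q = 0 := by
  refine (𝒬 M).canonical_eq_zero (t M) (fun v f hf x => ?_) q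
  refine sum_perm_eq_zero_of_sum_eq_zero s (fun N J => ∑ q, t N q (fun j => v (J j)) *
    ((𝒬 N).graph q).contract (fun j => f (J j)) x) (fun y => ?_) hM
  rw [← h (fun m => y m • v m) f hf x]
  refine Finset.sum_congr rfl fun N _ => ?_
  rw [Finset.sum_comm]
  refine Finset.sum_congr rfl fun J _ => ?_
  rw [Finset.sum_mul]
  refine Finset.sum_congr rfl fun q _ => ?_
  rw [(t N q).map_smul_univ (fun j => y (J j)) fun j => v (J j), smul_eq_mul]
  ring

/-- At fixed `u`, the tensors at `ρ g u` pulled back by `ρ g`, minus those at `u`, define a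
vanishing expression on arbitrary derivatives. Hence the canonical form of the difference is zero,
and it is the difference of the canonical forms. -/
theorem canonical_tensorInvariant {d n : ℕ} {G : Type*} [Group G]
    {ρ : Representation ℝ G (FieldSpace n)} (𝒬 : ∀ N, ContractionFamily N) (s : Finset ℕ)
    (hpos : ∀ N q j, 0 < ((𝒬 N).graph q).numDerivs j)
    (t : ∀ N, (𝒬 N).Index → FieldSpace n →
      ContinuousMultilinearMap ℝ (fun _ : Fin N => FieldSpace n) ℝ)
    (h : Functional.IsInvariant ρ (∑ N ∈ s, ∑ q, ((𝒬 N).graph q).term d (t N q)))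
    {N : ℕ} (hN : N ∈ s) (q : (𝒬 N).Index) :
    TensorInvariant ρ fun u => (𝒬 N).canonical d (fun q => t N q u) q := by
  intro g u v
  have key := canonical_eq_zero_of_sum_eq_zero (d := d) (M := N) 𝒬 s
    (fun N q => (t N q (ρ g u)).compContinuousLinearMap (fun _ => flavourMap ρ g) - t N q u)
    (fun v f hf x => ?_) hN q
  · rw [canonical_sub_compContinuousLinearMap, sub_eq_zero] at key
    exact congrArg (fun T => T v) key
  -- The constant offset is chosen so that `φ` takes the value `u` at `x`; the test functions remain
  -- arbitrary.
  · let φ : Config d n := ⟨fun y => (u - ∑ m, f m x • v m) + ∑ m, f m y • v m,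
      contDiff_const.add (ContDiff.sum fun m _ => (hf m).smul contDiff_const)⟩
    have hφ : φ.1 x = u := sub_add_cancel _ _
    have hφ' : (φ.transform ρ g).1 x = ρ g u := congrArg (ρ g) hφ
    have h₁ := congrFun (h g φ) x
    rw [← sub_eq_zero] at h₁
    simp only [Finset.sum_apply, Contraction.term_eq_termCoeffs, hφ, hφ',
      Contraction.termCoeffs_transform] at h₁
    have h₂ : ∀ {N k : ℕ} (Γ : Contraction N k), (∀ j, 0 < Γ.numDerivs j) → ∀ T,
        Γ.termCoeffs T (fun _ i l => iterD l (φ.component i) x) = _ := fun Γ hΓ T =>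
      Γ.termCoeffs_affine T φ _ v hf (fun _ => rfl) (Or.inl hΓ) x
    simp only [h₂ _ (hpos _ _)] at h₁
    rw [← h₁, ← Finset.sum_sub_distrib]
    refine Finset.sum_congr rfl fun N _ => ?_
    rw [← Finset.sum_sub_distrib]
    refine Finset.sum_congr rfl fun q _ => ?_
    rw [← Finset.sum_sub_distrib]
    refine Finset.sum_congr rfl fun J _ => ?_
    rw [sub_apply, sub_mul]

theorem sum_term_canonical {N : ℕ} (𝒬 : ContractionFamily N) {d n : ℕ}
    (t : 𝒬.Index → FieldSpace n →
      ContinuousMultilinearMap ℝ (fun _ : Fin N => FieldSpace n) ℝ) :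
    ∑ q, (𝒬.graph q).term d (fun u => 𝒬.canonical d (fun q => t q u) q) =
      ∑ q, (𝒬.graph q).term d (t q) := by
  funext φ x
  simp only [Finset.sum_apply, Contraction.term_eq_termCoeffs]
  exact 𝒬.sum_termCoeffs_canonical (fun q => t q (φ.1 x)) φ x

end ContractionFamily

/-! ### Representation of Lagrangians by differentiated fields -/

theorem Contraction.term_add {d n N k : ℕ} (Γ : Contraction N k)
    (t t' : FieldSpace n → ContinuousMultilinearMap ℝ (fun _ : Fin N => FieldSpace n) ℝ) :
    Γ.term d (t + t') = Γ.term d t + Γ.term d t' := by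
  funext φ x
  simp [Contraction.term, add_mul, Finset.sum_add_distrib]

theorem Contraction.term_smul {d n N k : ℕ} (Γ : Contraction N k) (c : ℝ)
    (t : FieldSpace n → ContinuousMultilinearMap ℝ (fun _ : Fin N => FieldSpace n) ℝ) :
    Γ.term d (c • t) = c • Γ.term d t := by
  funext φ x
  simp [Contraction.term, Finset.mul_sum, mul_assoc]

theorem Contraction.term_zero {d n N k : ℕ} (Γ : Contraction N k) :
    Γ.term d (0 : FieldSpace n → ContinuousMultilinearMap ℝ (fun _ : Fin N => FieldSpace n) ℝ) =
      0 := by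
  funext φ x
  simp [Contraction.term]

/-- The Lagrangians with at most `2 (r + 1)` derivatives, without boxes if `b` holds. -/
def lagrangiansWith (d n r : ℕ) (b : Prop) : Submodule ℝ (Functional d n) :=
  Submodule.span ℝ {F | ∃ (N k : ℕ) (Γ : Contraction N k)
    (t : FieldSpace n → ContinuousMultilinearMap ℝ (fun _ : Fin N => FieldSpace n) ℝ),
      k ≤ r + 1 ∧ (b → Γ.BoxFree) ∧ ContDiff ℝ ∞ t ∧ F = Γ.term d t}

/-- Fields without derivatives are stripped off one at a time. This bounds the number of remaining
fields, so all Lagrangians can be written over one finite family of patterns. -/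
theorem exists_differentiated_term {d n r N k : ℕ} {b : Prop} (Γ : Contraction N k)
    {t : FieldSpace n → ContinuousMultilinearMap ℝ (fun _ : Fin N => FieldSpace n) ℝ}
    (hk : k ≤ r + 1) (hb : b → Γ.BoxFree) (ht : ContDiff ℝ ∞ t) :
    ∃ (N' : ℕ) (q : (ContractionFamily.differentiated r b N').Index)
      (t' : FieldSpace n → ContinuousMultilinearMap ℝ (fun _ : Fin N' => FieldSpace n) ℝ),
      N' ∈ Finset.range (2 * r + 3) ∧ ContDiff ℝ ∞ t' ∧ Γ.term d t =
        ((ContractionFamily.differentiated r b N').graph q).term d t' := by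
  induction N with
  | zero =>
    exact ⟨0, ⟨⟨⟨k, by omega⟩, Γ⟩, fun j => j.elim0, hb⟩, t, by simp, ht, rfl⟩
  | succ N ih =>
    by_cases h : ∃ j, Γ.numDerivs j = 0
    · obtain ⟨j, hj⟩ := h
      obtain ⟨Γ', rfl⟩ := Contraction.exists_eq_insertBare hj
      rw [Contraction.term_insertBare]
      exact ih Γ' (fun h => (hb h).of_insertBare) (contDiff_curryMid_self j ht)
    · have hpos : ∀ j, 0 < Γ.numDerivs j := fun j => Nat.pos_of_ne_zero fun hj => h ⟨j, hj⟩
      refine ⟨N + 1, ⟨⟨⟨k, by omega⟩, Γ⟩, hpos, hb⟩, t, ?_, ht, rfl⟩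
      -- Each field takes at least one of the `2k` derivatives, so there are at most `2k ≤ 2r + 2`
      -- fields.
      have h₁ := Finset.sum_le_sum fun j (_ : j ∈ Finset.univ) => Nat.succ_le_of_lt (hpos j)
      rw [Γ.sum_numDerivs] at h₁
      simp at h₁
      rw [Finset.mem_range]
      omega

theorem exists_differentiated_tensors {d n r : ℕ} {b : Prop} {L : Functional d n}
    (hL : L ∈ lagrangiansWith d n r b) :
    ∃ t : ∀ N, (ContractionFamily.differentiated r b N).Index → FieldSpace n →
        ContinuousMultilinearMap ℝ (fun _ : Fin N => FieldSpace n) ℝ,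
      (∀ N q, ContDiff ℝ ∞ (t N q)) ∧ L = ∑ N ∈ Finset.range (2 * r + 3), ∑ q,
        ((ContractionFamily.differentiated r b N).graph q).term d (t N q) := by
  classical
  induction hL using Submodule.span_induction with
  | mem F hF =>
    obtain ⟨N, k, Γ, t, hk, hb, ht, rfl⟩ := hF
    obtain ⟨N', q, t', hN', ht', hF⟩ := exists_differentiated_term (d := d) Γ hk hb ht
    refine ⟨Function.update 0 N' (Function.update 0 q t'), fun N q' => ?_, ?_⟩
    · rcases eq_or_ne N N' with rfl | hN
      · rw [Function.update_self]
        rcases eq_or_ne q' q with rfl | hq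
        · rwa [Function.update_self]
        · rw [Function.update_of_ne hq]
          exact contDiff_const
      · rw [Function.update_of_ne hN]
        exact contDiff_const
    · rw [hF, Finset.sum_eq_single_of_mem N' hN', Finset.sum_eq_single q]
      · simp
      · intro q' _ hq
        simp [Function.update_of_ne hq, Contraction.term_zero]
      · simp
      · intro N _ hN
        simp [Function.update_of_ne hN, Contraction.term_zero]
  | zero => exact ⟨0, fun _ _ => contDiff_const, by simp [Contraction.term_zero]⟩
  | add F F' _ _ hF hF' =>
    obtain ⟨t, ht, rfl⟩ := hF
    obtain ⟨t', ht', rfl⟩ := hF'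
    exact ⟨t + t', fun N q => (ht N q).add (ht' N q), by
      simp [Contraction.term_add, Finset.sum_add_distrib]⟩
  | smul c F _ hF =>
    obtain ⟨t, ht, rfl⟩ := hF
    exact ⟨c • t, fun N q => (ht N q).const_smul c, by
      simp [Contraction.term_smul, Finset.smul_sum]⟩

/-- An invariant Lagrangian is a sum of terms with covariant flavour tensors. -/
theorem exists_covariant_tensors {d n r : ℕ} {G : Type*} [Group G]
    {ρ : Representation ℝ G (FieldSpace n)} {b : Prop} {L : Functional d n}
    (hL : L ∈ lagrangiansWith d n r b) (hρ : Functional.IsInvariant ρ L) :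
    ∃ t : ∀ N, (ContractionFamily.differentiated r b N).Index → FieldSpace n →
        ContinuousMultilinearMap ℝ (fun _ : Fin N => FieldSpace n) ℝ,
      (∀ N ∈ Finset.range (2 * r + 3), ∀ q, ContDiff ℝ ∞ (t N q) ∧ TensorInvariant ρ (t N q)) ∧
      L = ∑ N ∈ Finset.range (2 * r + 3), ∑ q,
        ((ContractionFamily.differentiated r b N).graph q).term d (t N q) := by
  obtain ⟨t, ht, rfl⟩ := exists_differentiated_tensors hL
  refine ⟨fun N q u => (ContractionFamily.differentiated r b N).canonical d (fun q => t N q u) q,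
    fun N hN q => ⟨ContractionFamily.contDiff_canonical _ d (ht N) q,
      ContractionFamily.canonical_tensorInvariant 
        (ContractionFamily.differentiated r b) _ (fun _ q => q.2.1) t hρ hN q⟩,
    Finset.sum_congr rfl fun N _ => (ContractionFamily.sum_term_canonical _ (t N)).symm⟩

/-- An invariant Lagrangian with constant flavour tensors is a sum of terms with invariant flavour
tensors. -/
theorem exists_invariant_tensors {d n N k : ℕ} {G : Type*} [Group G]
    {ρ : Representation ℝ G (FieldSpace n)} {L : Functional d n}
    (hL : L ∈ homogeneousLagrangians d n N k) (hρ : Functional.IsInvariant ρ L) :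
    ∃ t : Contraction N k → ContinuousMultilinearMap ℝ (fun _ : Fin N => FieldSpace n) ℝ,
      (∀ Γ (g : G) v, t Γ (fun j => ρ g (v j)) = t Γ v) ∧ L = ∑ Γ : Contraction N k, Γ.term d fun _ => t Γ := by
  classical
  have h : ∃ t : Contraction N k → ContinuousMultilinearMap ℝ (fun _ : Fin N => FieldSpace n) ℝ,
      L = ∑ Γ : Contraction N k, Γ.term d fun _ => t Γ := by
    clear hρ
    induction hL using Submodule.span_induction with
    | mem F hF =>
      obtain ⟨Γ, t, rfl⟩ := hF
      refine ⟨Function.update 0 Γ t, ?_⟩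
      rw [Finset.sum_eq_single Γ]
      · simp
      · intro Γ' _ hΓ
        rw [Function.update_of_ne hΓ]
        exact Γ'.term_zero
      · simp
    | zero => exact ⟨0, (Finset.sum_eq_zero fun Γ _ => Γ.term_zero).symm⟩
    | add F F' _ _ hF hF' =>
      obtain ⟨t, rfl⟩ := hF
      obtain ⟨t', rfl⟩ := hF'
      refine ⟨t + t', ?_⟩
      rw [← Finset.sum_add_distrib]
      exact Finset.sum_congr rfl fun Γ _ => (Γ.term_add _ _).symm
    | smul c F _ hF =>
      obtain ⟨t, rfl⟩ := hF
      refine ⟨c • t, ?_⟩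
      rw [Finset.smul_sum]
      exact Finset.sum_congr rfl fun Γ _ => (Γ.term_smul _ _).symm
  obtain ⟨t, rfl⟩ := h
  refine ⟨(ContractionFamily.all N k).canonical d t, fun Γ g v => ?_,
    ((ContractionFamily.all N k).sum_term_canonical fun Γ _ => t Γ).symm⟩
  -- With constant tensors and a fixed number of fields, bare fields may stay: the test
  -- configurations have no constant part. The family of tensors is supported at `N` alone.
  have key := ContractionFamily.canonical_eq_zero_of_sum_eq_zero (d := d) (M := N)
    (fun N' => ContractionFamily.all N' k) {N} (Function.update 0 N fun Γ =>
      (t Γ).compContinuousLinearMap (fun _ => flavourMap ρ g) - t Γ)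
    (fun v f hf x => ?_) (by simp) Γ
  · rw [Function.update_self] at key
    exact congrArg (fun T => T v) (sub_eq_zero.1
      (((ContractionFamily.all N k).canonical_sub_compContinuousLinearMap d t t
        (flavourMap ρ g) Γ).symm.trans key))
  · let φ : Config d n := ⟨fun y => 0 + ∑ m, f m y • v m,
      contDiff_const.add (ContDiff.sum fun m _ => (hf m).smul contDiff_const)⟩
    have h₁ := congrFun (hρ g φ) x
    rw [← sub_eq_zero] at h₁
    simp only [Finset.sum_apply, Contraction.term_eq_termCoeffs,
      Contraction.termCoeffs_transform] at h₁
    have h₂ : ∀ (Γ : Contraction N k) T,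
        Γ.termCoeffs T (fun _ i l => iterD l (φ.component i) x) = _ := fun Γ T =>
      Γ.termCoeffs_affine T φ 0 v hf (fun _ => rfl) (Or.inr rfl) x
    simp only [h₂] at h₁
    rw [Finset.sum_singleton, Function.update_self, ← h₁, ← Finset.sum_sub_distrib]
    refine Finset.sum_congr rfl fun Γ _ => ?_
    rw [← Finset.sum_sub_distrib]
    refine Finset.sum_congr rfl fun J _ => ?_
    rw [sub_apply, sub_mul]
    rfl

/-! ### Lorentz invariance of contractions -/

namespace Contraction

variable {N k : ℕ}

/-- Add a derivative `∂_μ` to the `s`-th field. -/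
def shift {d : ℕ} (s : Fin N) (μ : Fin d) (c : Fin N → List (Fin d) → ℝ) :
    Fin N → List (Fin d) → ℝ :=
  Function.update c s fun l => c s (μ :: l)

/-- Remove the pair `0` of derivatives. -/
def tail (Γ : Contraction N (k + 1)) : Contraction N k := ⟨Fin.tail Γ.src, Fin.tail Γ.tgt⟩

theorem BoxFree.tail {Γ : Contraction N (k + 1)} (h : Γ.BoxFree) : Γ.tail.BoxFree :=
  fun e => h e.succ

theorem shift_shift_apply {d : ℕ} (s t : Fin N) (μ ν : Fin d) (c : Fin N → List (Fin d) → ℝ)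
    (j : Fin N) (l : List (Fin d)) : shift t ν (shift s μ c) j l =
      c j ((if s = j then [μ] else []) ++ (if t = j then [ν] else []) ++ l) := by
  unfold shift
  rcases eq_or_ne j t with rfl | ht
  · rw [Function.update_self, if_pos rfl]
    rcases eq_or_ne j s with rfl | hs
    · simp
    · rw [Function.update_of_ne hs, if_neg hs.symm]
      simp
  · rw [Function.update_of_ne ht, if_neg ht.symm]
    rcases eq_or_ne j s with rfl | hs
    · simp
    · rw [Function.update_of_ne hs, if_neg hs.symm]
      simp

theorem indicesAt_cons {d : ℕ} (Γ : Contraction N (k + 1)) (μ₀ ν₀ : Fin d) (μ ν : Fin k → Fin d)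
    (j : Fin N) : Γ.indicesAt (Fin.cons μ₀ μ : Fin (k + 1) → Fin d) (Fin.cons ν₀ ν) j =
      (if Γ.src 0 = j then [μ₀] else []) ++ (if Γ.tgt 0 = j then [ν₀] else []) ++
        Γ.tail.indicesAt μ ν j := by
  simp only [indicesAt, List.finRange_succ, List.flatMap_cons, List.flatMap_map, Fin.cons_zero,
    Fin.cons_succ]
  rfl

theorem sum_fin_succ_arrow {d : ℕ} (F : (Fin (k + 1) → Fin d) → ℝ) :
    ∑ μ, F μ = ∑ μ₀, ∑ μ : Fin k → Fin d, F (Fin.cons μ₀ μ) := by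
  rw [← (Fin.consEquiv fun _ => Fin d).sum_comp, Fintype.sum_prod_type]
  rfl

/-- Peeling off pair `0` drives the induction for Lorentz invariance, and it also exhibits the two
slots that tangent vectors fill in the metric. -/
theorem contractCoeffs_succ {d : ℕ} (Γ : Contraction N (k + 1))
    (c : Fin N → List (Fin d) → ℝ) : Γ.contractCoeffs c = ∑ μ, ∑ ν, (minkowski d)⁻¹ μ ν *
      Γ.tail.contractCoeffs (shift (Γ.tgt 0) ν (shift (Γ.src 0) μ c)) := by
  unfold contractCoeffs
  rw [sum_fin_succ_arrow]
  refine Finset.sum_congr rfl fun μ₀ _ => ?_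
  conv_lhs => enter [2, μ]; rw [sum_fin_succ_arrow]
  rw [Finset.sum_comm]
  refine Finset.sum_congr rfl fun ν₀ _ => ?_
  simp only [Finset.mul_sum, Fin.prod_univ_succ, Fin.cons_zero, Fin.cons_succ,
    indicesAt_cons, shift_shift_apply, mul_assoc]

theorem contractCoeffs_update_sum {d : ℕ} {κ : Type*} [Fintype κ] (Γ : Contraction N k)
    (c : Fin N → List (Fin d) → ℝ) (s : Fin N) (a : κ → ℝ) (f : κ → List (Fin d) → ℝ) :
    Γ.contractCoeffs (Function.update c s fun l => ∑ m, a m * f m l) =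
      ∑ m, a m * Γ.contractCoeffs (Function.update c s (f m)) := by
  have h : ∀ (g : List (Fin d) → ℝ) (μ ν : Fin k → Fin d),
      ∏ j, Function.update c s g j (Γ.indicesAt μ ν j) =
        g (Γ.indicesAt μ ν s) * ∏ j ∈ Finset.univ.erase s, c j (Γ.indicesAt μ ν j) := by
    intro g μ ν
    rw [← Finset.mul_prod_erase _ _ (Finset.mem_univ s), Function.update_self]
    congr 1
    refine Finset.prod_congr rfl fun j hj => ?_
    rw [Function.update_of_ne (Finset.ne_of_mem_erase hj)]
  simp only [contractCoeffs, h, Finset.mul_sum, Finset.sum_mul]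
  refine Eq.trans ?_ Finset.sum_comm
  refine Finset.sum_congr rfl fun _ _ => ?_
  rw [Finset.sum_comm]
  exact Finset.sum_congr rfl fun _ _ => Finset.sum_congr rfl fun _ _ => by ring

/-- Linearity in slot `s` persists after a further derivative on `t`. The cases differ because for
`s = t` both derivatives land on the same slot. -/
theorem contractCoeffs_shift_update_sum {d : ℕ} {κ : Type*} [Fintype κ] (Γ : Contraction N k)
    (c : Fin N → List (Fin d) → ℝ) (s t : Fin N) (ν : Fin d) (a : κ → ℝ)
    (f : κ → List (Fin d) → ℝ) :
    Γ.contractCoeffs (shift t ν (Function.update c s fun l => ∑ m, a m * f m l)) =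
      ∑ m, a m * Γ.contractCoeffs (shift t ν (Function.update c s (f m))) := by
  rcases eq_or_ne s t with rfl | h
  · have : ∀ g, shift s ν (Function.update c s g) = Function.update c s fun l => g (ν :: l) := by
      intro g
      simp [shift]
    simp only [this]
    exact Γ.contractCoeffs_update_sum c s a fun m l => f m (ν :: l)
  · have : ∀ g, shift t ν (Function.update c s g) = Function.update (shift t ν c) s g := by
      intro g
      simp [shift, Function.update_of_ne h.symm, Function.update_comm h]
    simp only [this]
    exact Γ.contractCoeffs_update_sum _ s a f

/-- The coefficients of the derivatives after a linear change of the spacetime coordinates. -/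
def changeCoords {d : ℕ} (A : Matrix (Fin d) (Fin d) ℝ) (c : List (Fin d) → ℝ)
    (l : List (Fin d)) : ℝ :=
  ∑ l' : Fin l.length → Fin d, (∏ s, A (l' s) (l.get s)) * c (List.ofFn l')

theorem changeCoords_nil {d : ℕ} (A : Matrix (Fin d) (Fin d) ℝ) (c : List (Fin d) → ℝ) :
    changeCoords A c [] = c [] := by
  change ∑ l' : Fin 0 → Fin d, (∏ s : Fin 0, _) * c (List.ofFn l') = _
  simp

theorem changeCoords_cons {d : ℕ} (A : Matrix (Fin d) (Fin d) ℝ) (c : List (Fin d) → ℝ)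
    (μ : Fin d) (l : List (Fin d)) : changeCoords A c (μ :: l) =
      ∑ μ', A μ' μ * changeCoords A (fun l' => c (μ' :: l')) l := by
  unfold changeCoords
  refine (sum_fin_succ_arrow (k := l.length) _).trans ?_
  refine Finset.sum_congr rfl fun μ' _ => ?_
  rw [Finset.mul_sum]
  refine Finset.sum_congr rfl fun l' _ => ?_
  rw [← mul_assoc]
  congr 1
  · exact Fin.prod_univ_succ _
  · simp [List.ofFn_succ]

theorem sum_sum_mul_sum_sum {d : ℕ} {A η η' : Matrix (Fin d) (Fin d) ℝ}
    (h : ∀ μ' ν', ∑ μ, ∑ ν, A μ' μ * η μ ν * A ν' ν = η' μ' ν') (T : Fin d → Fin d → ℝ) :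
    ∑ μ, ∑ ν, η μ ν * ∑ μ', A μ' μ * ∑ ν', A ν' ν * T μ' ν' = ∑ μ', ∑ ν', η' μ' ν' * T μ' ν' := by
  simp only [← h, Finset.mul_sum, Finset.sum_mul]
  refine (Finset.sum_congr rfl fun _ _ => Finset.sum_comm).trans (Finset.sum_comm.trans ?_)
  refine Finset.sum_congr rfl fun μ' _ => ?_
  refine (Finset.sum_congr rfl fun _ _ => Finset.sum_comm).trans (Finset.sum_comm.trans ?_)
  exact Finset.sum_congr rfl fun ν' _ => Finset.sum_congr rfl fun μ _ =>
    Finset.sum_congr rfl fun ν _ => by ring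

/-- Induction on the number of pairs: the two index changes of pair `0` combine with `η^{-1}` to `A
η^{-1} Aᵀ = η^{-1}`. -/
theorem contractCoeffs_changeCoords {d : ℕ} (Γ : Contraction N k) {A : Matrix (Fin d) (Fin d) ℝ}
    (hA : A * (minkowski d)⁻¹ * A.transpose = (minkowski d)⁻¹) (c : Fin N → List (Fin d) → ℝ) :
    Γ.contractCoeffs (fun j => changeCoords A (c j)) = Γ.contractCoeffs c := by
  induction k generalizing c with
  | zero =>
    refine Γ.contractCoeffs_congr fun j μ ν => ?_
    exact changeCoords_nil A (c j)
  | succ k ih =>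
    have hs : ∀ (c : Fin N → List (Fin d) → ℝ) (s : Fin N) (μ : Fin d),
        shift s μ (fun j => changeCoords A (c j)) =
          Function.update (fun j => changeCoords A (c j)) s
            fun l => ∑ μ', A μ' μ * changeCoords A (fun l' => c s (μ' :: l')) l := by
      intro c s μ
      unfold shift
      simp only [changeCoords_cons]
    have hs' : ∀ (c : Fin N → List (Fin d) → ℝ) (s : Fin N) (μ' : Fin d),
        Function.update (fun j => changeCoords A (c j)) s
          (changeCoords A fun l' => c s (μ' :: l')) = fun j => changeCoords A (shift s μ' c j) := by
      intro c s μ'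
      funext j
      unfold shift
      rcases eq_or_ne j s with rfl | h
      · simp
      · simp [Function.update_of_ne h]
    have key : ∀ μ ν, Γ.tail.contractCoeffs
        (shift (Γ.tgt 0) ν (shift (Γ.src 0) μ fun j => changeCoords A (c j))) =
        ∑ μ', A μ' μ * ∑ ν', A ν' ν *
          Γ.tail.contractCoeffs (shift (Γ.tgt 0) ν' (shift (Γ.src 0) μ' c)) := by
      intro μ ν
      rw [hs c, contractCoeffs_shift_update_sum]
      refine Finset.sum_congr rfl fun μ' _ => ?_
      congr 1
      rw [hs', hs, contractCoeffs_update_sum]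
      refine Finset.sum_congr rfl fun ν' _ => ?_
      congr 1
      exact (congrArg _ (hs' _ _ _)).trans (ih Γ.tail _)
    have hA' : ∀ μ' ν', ∑ μ, ∑ ν, A μ' μ * (minkowski d)⁻¹ μ ν * A ν' ν =
        (minkowski d)⁻¹ μ' ν' := by
      intro μ' ν'
      conv_rhs => rw [← hA]
      simp only [Matrix.mul_apply, Matrix.transpose_apply, Finset.sum_mul]
      rw [Finset.sum_comm]
    rw [contractCoeffs_succ, contractCoeffs_succ]
    simp only [key]
    exact sum_sum_mul_sum_sum hA' _

end Contraction

theorem minkowski_transpose (d : ℕ) : (minkowski d).transpose = minkowski d :=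
  Matrix.diagonal_transpose _

theorem minkowski_mul_self (d : ℕ) : minkowski d * minkowski d = 1 := by
  rw [minkowski, Matrix.diagonal_mul_diagonal, ← Matrix.diagonal_one]
  congr 1
  funext μ
  split_ifs <;> simp

theorem minkowski_inv (d : ℕ) : (minkowski d)⁻¹ = minkowski d :=
  Matrix.inv_eq_left_inv (minkowski_mul_self d)

/-- The matrix of the inverse of a linear change of coordinates. -/
def inverseMatrix {d : ℕ} (Λ : Spacetime d ≃L[ℝ] Spacetime d) : Matrix (Fin d) (Fin d) ℝ :=
  LinearMap.toMatrix' (Λ.symm : Spacetime d →ₗ[ℝ] Spacetime d)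

/-- With `M` the matrix of `Λ`, being Lorentz says `Mᵀ η M = η`; inverting both sides gives the
claim. -/
theorem IsLorentz.inverseMatrix_mul {d : ℕ} {Λ : Spacetime d ≃L[ℝ] Spacetime d}
    (h : IsLorentz Λ) : inverseMatrix Λ * (minkowski d)⁻¹ * (inverseMatrix Λ).transpose =
      (minkowski d)⁻¹ := by
  let M : Matrix (Fin d) (Fin d) ℝ := LinearMap.toMatrix' (Λ : Spacetime d →ₗ[ℝ] Spacetime d)
  have hM : M.transpose * minkowski d * M = minkowski d := by
    refine Matrix.ext_of_mulVec_single fun ν => ?_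
    funext μ
    have := h (Pi.single μ 1) (Pi.single ν 1)
    have hv : ∀ v, Λ v = M.mulVec v := fun v =>
      (LinearMap.toMatrix'_mulVec (Λ : Spacetime d →ₗ[ℝ] Spacetime d) v).symm
    rw [hv, hv, single_one_dotProduct] at this
    rw [← this, ← single_one_dotProduct (v := Matrix.mulVec _ _) μ, ← Matrix.mulVec_mulVec,
      ← Matrix.mulVec_mulVec, Matrix.dotProduct_mulVec _ M.transpose, Matrix.vecMul_transpose]
  have hMA : inverseMatrix Λ * M = 1 := by
    rw [inverseMatrix, ← LinearMap.toMatrix'_comp, ← LinearMap.toMatrix'_id]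
    congr 1
    ext v
    simp
  rw [← Matrix.inv_eq_left_inv hMA, Matrix.transpose_nonsing_inv]
  conv_rhs => rw [← hM]
  rw [Matrix.mul_inv_rev, Matrix.mul_inv_rev, mul_assoc]

/-! ### Coordinates on the jet bundle -/

/-- The underlying multilinear map, as a continuous linear map. -/
def SymTensor.toMultilinearL (d n k : ℕ) : SymTensor d n k →L[ℝ]
    ContinuousMultilinearMap ℝ (fun _ : Fin k => Spacetime d) (FieldSpace n) :=
  (symTensorSubmodule d n k).subtypeL

/-- A linear map with symmetric values, as a map to `SymTensor`. -/
def SymTensor.codRestrict {d n k : ℕ} {E : Type*} [NormedAddCommGroup E] [NormedSpace ℝ E]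
    (f : E →L[ℝ] ContinuousMultilinearMap ℝ (fun _ : Fin k => Spacetime d) (FieldSpace n))
    (hf : ∀ x (σ : Equiv.Perm (Fin k)) (v : Fin k → Spacetime d), f x (v ∘ σ) = f x v) :
    E →L[ℝ] SymTensor d n k :=
  ContinuousLinearMap.codRestrict f (symTensorSubmodule d n k) hf

theorem SymTensor.codRestrict_apply {d n k : ℕ} {E : Type*} [NormedAddCommGroup E]
    [NormedSpace ℝ E]
    (f : E →L[ℝ] ContinuousMultilinearMap ℝ (fun _ : Fin k => Spacetime d) (FieldSpace n))
    (hf : ∀ x (σ : Equiv.Perm (Fin k)) (v : Fin k → Spacetime d), f x (v ∘ σ) = f x v) (x : E) :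
    SymTensor.codRestrict f hf x = SymTensor.mk (f x) (hf x) := rfl

theorem SymTensor.mk_congr {d n k : ℕ}
    {f f' : ContinuousMultilinearMap ℝ (fun _ : Fin k => Spacetime d) (FieldSpace n)} (h : f = f')
    (hf : ∀ (σ : Equiv.Perm (Fin k)) (v : Fin k → Spacetime d), f (v ∘ σ) = f v)
    (hf' : ∀ (σ : Equiv.Perm (Fin k)) (v : Fin k → Spacetime d), f' (v ∘ σ) = f' v) :
    SymTensor.mk f hf = SymTensor.mk f' hf' := by
  subst h
  rfl

/-- The sum over permutations of the arguments, divided by their number. -/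
def symmetrizeL (d n k : ℕ) :
    ContinuousMultilinearMap ℝ (fun _ : Fin k => Spacetime d) (FieldSpace n) →L[ℝ]
      ContinuousMultilinearMap ℝ (fun _ : Fin k => Spacetime d) (FieldSpace n) :=
  (k.factorial : ℝ)⁻¹ • ∑ σ : Equiv.Perm (Fin k),
    (ContinuousMultilinearMap.domDomCongrₗᵢ ℝ (Spacetime d) (FieldSpace n)
      σ).toContinuousLinearEquiv.toContinuousLinearMap

theorem symmetrizeL_apply {d n k : ℕ}
    (f : ContinuousMultilinearMap ℝ (fun _ : Fin k => Spacetime d) (FieldSpace n))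
    (v : Fin k → Spacetime d) : symmetrizeL d n k f v =
      (k.factorial : ℝ)⁻¹ • ∑ σ : Equiv.Perm (Fin k), f (v ∘ σ) := by
  have h : symmetrizeL d n k f = (k.factorial : ℝ)⁻¹ • ∑ σ : Equiv.Perm (Fin k),
      f.domDomCongr σ := by
    rw [symmetrizeL, smul_apply, sum_apply]
    rfl
  rw [h, smul_apply, sum_apply]
  rfl

/-- Symmetrisation, a continuous projection onto the symmetric multilinear maps. -/
def SymTensor.symmetrize (d n k : ℕ) :
    ContinuousMultilinearMap ℝ (fun _ : Fin k => Spacetime d) (FieldSpace n) →L[ℝ]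
      SymTensor d n k :=
  SymTensor.codRestrict (symmetrizeL d n k) fun f τ v => by
    rw [symmetrizeL_apply, symmetrizeL_apply]
    congr 1
    exact Fintype.sum_equiv (Equiv.mulLeft τ) _ _ fun σ => rfl

theorem SymTensor.symmetrize_apply {d n k : ℕ}
    (f : ContinuousMultilinearMap ℝ (fun _ : Fin k => Spacetime d) (FieldSpace n))
    (hf : ∀ (σ : Equiv.Perm (Fin k)) (v : Fin k → Spacetime d), f (v ∘ σ) = f v) :
    SymTensor.symmetrize d n k f = SymTensor.mk f hf := by
  rw [symmetrize, codRestrict_apply]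
  refine SymTensor.mk_congr ?_ _ _
  ext1 v
  rw [symmetrizeL_apply]
  simp [hf, smul_smul, ← Nat.cast_smul_eq_nsmul ℝ, Fintype.card_perm,
    inv_mul_cancel₀ (Nat.cast_ne_zero.2 k.factorial_ne_zero : (k.factorial : ℝ) ≠ 0)]

/-- The jet coordinates take values in a subspace of multilinear maps. Symmetrisation fixes
symmetric maps, so each coordinate is a continuous linear map applied to an iterated derivative. -/
theorem differentiable_prolong {d n : ℕ} (r : ℕ) (φ : Config d n) :
    Differentiable ℝ (prolong r φ) := by
  refine differentiable_id.prodMk (differentiable_pi.2 fun k => ?_)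
  have h : (fun x => SymTensor.mk (iteratedFDeriv ℝ (k : ℕ) φ.1 x)
      fun σ v => iteratedFDeriv_perm k φ.2 σ x v) =
      fun x => SymTensor.symmetrize d n k (iteratedFDeriv ℝ (k : ℕ) φ.1 x) :=
    funext fun x => (SymTensor.symmetrize_apply _ _).symm
  rw [h]
  exact (SymTensor.symmetrize d n k).differentiable.comp
    (φ.2.differentiable_iteratedFDeriv (by exact_mod_cast WithTop.coe_lt_top _))

namespace Jet

variable {d n r : ℕ}

/-- The jet coordinate `u^i_{μ_1 … μ_k}`, or zero if `k > r`. -/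
def coord (l : List (Fin d)) (i : Fin n) : Jet d n r →L[ℝ] ℝ :=
  if h : l.length < r + 1 then
    (ContinuousLinearMap.proj (R := ℝ) (φ := fun _ : Fin n => ℝ) i) ∘L
      (ContinuousMultilinearMap.apply ℝ (fun _ : Fin l.length => Spacetime d) (FieldSpace n)
        fun s => basisVec (l.get s)) ∘L
      (SymTensor.toMultilinearL d n l.length) ∘L
      (ContinuousLinearMap.proj (R := ℝ) (φ := fun k : Fin (r + 1) => SymTensor d n (k : ℕ))
        ⟨l.length, h⟩) ∘L
      (ContinuousLinearMap.snd ℝ (Spacetime d) ((k : Fin (r + 1)) → SymTensor d n (k : ℕ)))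
  else 0

theorem coord_apply {l : List (Fin d)} (h : l.length < r + 1) (i : Fin n) (p : Jet d n r) :
    coord l i p = (p.2 ⟨l.length, h⟩).toMultilinear (fun s => basisVec (l.get s)) i := by
  rw [coord, dif_pos h]
  rfl

theorem coord_of_length_eq {l : List (Fin d)} {m : ℕ} (hm : l.length = m) (h : m < r + 1)
    (i : Fin n) (p : Jet d n r) : coord l i p =
      (p.2 ⟨m, h⟩).toMultilinear (fun s => basisVec (l.get (s.cast hm.symm))) i := by
  subst hm
  exact coord_apply h i p

theorem coord_ofFn {m : ℕ} (h : m < r + 1) (l : Fin m → Fin d) (i : Fin n) (p : Jet d n r) :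
    coord (List.ofFn l) i p = (p.2 ⟨m, h⟩).toMultilinear (fun s => basisVec (l s)) i := by
  rw [coord_of_length_eq List.length_ofFn h]
  simp

/-- The field value at a jet. -/
def value : Jet d n r →L[ℝ] FieldSpace n := ContinuousLinearMap.pi fun i => coord [] i

theorem value_apply (p : Jet d n r) (i : Fin n) : value p i = coord [] i p := rfl

/-- The linear part of `Jet.map`. -/
def mapL (Λ : Spacetime d ≃L[ℝ] Spacetime d) (T : FieldSpace n →L[ℝ] FieldSpace n) :
    Jet d n r →L[ℝ] Jet d n r :=
  ((Λ : Spacetime d →L[ℝ] Spacetime d) ∘L ContinuousLinearMap.fst ℝ _ _).prod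
    (ContinuousLinearMap.pi fun k => (SymTensor.codRestrict
      ((ContinuousLinearMap.compContinuousMultilinearMapL ℝ (fun _ : Fin k => Spacetime d)
        (FieldSpace n) (FieldSpace n) T) ∘L
        (ContinuousMultilinearMap.compContinuousLinearMapL (F := FieldSpace n)
          fun _ : Fin k => (Λ.symm : Spacetime d →L[ℝ] Spacetime d)) ∘L
        SymTensor.toMultilinearL d n k)
      fun u σ v => congrArg T (u.symmetric σ fun j => Λ.symm (v j))) ∘L
      ContinuousLinearMap.proj k ∘L ContinuousLinearMap.snd ℝ _ _)

theorem mapL_eq_map (Λ : Spacetime d ≃L[ℝ] Spacetime d) (T : FieldSpace n →L[ℝ] FieldSpace n)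
    (p : Jet d n r) : mapL Λ T p = map Λ 0 T p :=
  Prod.ext (add_zero _).symm rfl

theorem fderiv_map (Λ : Spacetime d ≃L[ℝ] Spacetime d) (a : Spacetime d)
    (T : FieldSpace n →L[ℝ] FieldSpace n) (p : Jet d n r) :
    fderiv ℝ (map Λ a T) p = mapL Λ T := by
  have h : (map Λ a T : Jet d n r → Jet d n r) = fun p => mapL Λ T p + (a, 0) :=
    funext fun p => Prod.ext rfl (add_zero _).symm
  rw [h, fderiv_add_const, ContinuousLinearMap.fderiv]

theorem coord_map_flavour (a : Spacetime d) (T : FieldSpace n →L[ℝ] FieldSpace n)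
    (l : List (Fin d)) (i : Fin n) (p : Jet d n r) :
    coord l i (map (ContinuousLinearEquiv.refl ℝ (Spacetime d)) a T p) =
      ∑ m, T (Pi.single m 1) i * coord l m p := by
  by_cases h : l.length < r + 1
  · simp only [coord_apply h]
    change T ((p.2 ⟨l.length, h⟩).toMultilinear fun s => basisVec (l.get s)) i = _
    conv_lhs => rw [pi_eq_sum_univ' ((p.2 ⟨l.length, h⟩).toMultilinear
      fun s => basisVec (l.get s))]
    simp [mul_comm]
  · simp [coord, h]

theorem coord_map_spacetime (Λ : Spacetime d ≃L[ℝ] Spacetime d) (a : Spacetime d)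
    (l : List (Fin d)) (i : Fin n) (p : Jet d n r) :
    coord l i (map Λ a (ContinuousLinearMap.id ℝ (FieldSpace n)) p) =
      Contraction.changeCoords (inverseMatrix Λ) (fun l => coord l i p) l := by
  by_cases h : l.length < r + 1
  · rw [coord_apply h]
    change (p.2 ⟨l.length, h⟩).toMultilinear (fun s => Λ.symm (basisVec (l.get s))) i = _
    have h₁ : (fun s => Λ.symm (basisVec (l.get s))) = fun s : Fin l.length =>
        ∑ μ', inverseMatrix Λ μ' (l.get s) • (basisVec μ' : Spacetime d) := by
      funext s
      conv_lhs => rw [pi_eq_sum_univ' (Λ.symm (basisVec (l.get s)))]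
      simp [inverseMatrix, basisVec, LinearMap.toMatrix'_apply]
    rw [h₁, ContinuousMultilinearMap.map_sum, Finset.sum_apply]
    refine Finset.sum_congr rfl fun l' _ => ?_
    rw [ContinuousMultilinearMap.map_smul_univ, Pi.smul_apply, smul_eq_mul]
    congr 1
    exact (coord_ofFn h l' i p).symm
  · simp [coord, h, Contraction.changeCoords]

theorem coord_prolong {l : List (Fin d)} (h : l.length < r + 1) (i : Fin n) (φ : Config d n)
    (x : Spacetime d) : coord l i (prolong r φ x) = iterD l (φ.component i) x := by
  rw [coord_apply h]
  change iteratedFDeriv ℝ l.length φ.1 x (fun s => basisVec (l.get s)) i = _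
  clear h
  induction l generalizing x with
  | nil => rfl
  | cons μ l ih =>
    have hd := (φ.2.differentiable_iteratedFDeriv (m := l.length)
      (by exact_mod_cast WithTop.coe_lt_top _) x).hasFDerivAt
    have h₁ := hasFDerivAt_pi'.1
      (hd.continuousMultilinear_apply_const fun s => basisVec (l.get s)) i
    rw [iterD_cons, ← funext ih]
    change iteratedFDeriv ℝ (l.length + 1) φ.1 x (fun s => basisVec ((μ :: l).get s)) i = _
    rw [iteratedFDeriv_succ_apply_left]
    unfold partialD
    rw [h₁.fderiv]
    rfl

/-- Tangent vectors of a prolonged section carry one derivative more than the jet coordinates: this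
is how an `r`-jet metric reaches `r + 1` derivatives on a field. -/
theorem coord_fderiv_prolong {l : List (Fin d)} (h : l.length < r + 1) (i : Fin n)
    (φ : Config d n) (x : Spacetime d) (μ : Fin d) :
    coord l i (fderiv ℝ (prolong r φ) x (basisVec μ)) =
      iterD (μ :: l) (φ.component i) x := by
  have h₁ := ((coord l i).hasFDerivAt.comp x (differentiable_prolong r φ x).hasFDerivAt).fderiv
  have h₂ : coord l i ∘ prolong r φ = iterD l (φ.component i) :=
    funext fun x => coord_prolong h i φ x
  rw [iterD_cons, partialD, ← h₂, h₁]
  rfl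

theorem fst_fderiv_prolong (φ : Config d n) (x v : Spacetime d) :
    (fderiv ℝ (prolong r φ) x v).1 = v := by
  have h₁ := ((ContinuousLinearMap.fst ℝ (Spacetime d)
    ((k : Fin (r + 1)) → SymTensor d n (k : ℕ))).hasFDerivAt.comp x
      (differentiable_prolong r φ x).hasFDerivAt).fderiv
  have h₂ : (ContinuousLinearMap.fst ℝ (Spacetime d)
    ((k : Fin (r + 1)) → SymTensor d n (k : ℕ))) ∘ prolong r φ = id := rfl
  rw [h₂, fderiv_id] at h₁
  exact (DFunLike.congr_fun h₁ v).symm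

end Jet

/-! ### Jet bundle metrics of box-free terms -/

namespace Jet

variable {d n r : ℕ}

theorem value_map_spacetime (Λ : Spacetime d ≃L[ℝ] Spacetime d) (a : Spacetime d)
    (p : Jet d n r) :
    value (map Λ a (ContinuousLinearMap.id ℝ (FieldSpace n)) p) = value p := by
  funext i
  rw [value_apply, coord_map_spacetime, Contraction.changeCoords_nil, value_apply]

theorem value_map_flavour (a : Spacetime d) (T : FieldSpace n →L[ℝ] FieldSpace n)
    (p : Jet d n r) :
    value (map (ContinuousLinearEquiv.refl ℝ (Spacetime d)) a T p) = T (value p) := by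
  funext i
  rw [value_apply, coord_map_flavour]
  conv_rhs => rw [pi_eq_sum_univ' (value p)]
  simp [mul_comm, value_apply]

theorem value_prolong (φ : Config d n) (x : Spacetime d) : value (prolong r φ x) = φ.1 x := by
  funext i
  rw [value_apply, coord_prolong (Nat.succ_pos r)]
  rfl

end Jet

namespace JetMetric

variable {d n r : ℕ}

/-- The prolonged action is affine in the global jet coordinates, so tangent vectors transform by
its linear part, which is the action without translation. -/
theorem preservedBy_map_iff (g : JetMetric d n r) (Λ : Spacetime d ≃L[ℝ] Spacetime d)
    (a : Spacetime d) (T : FieldSpace n →L[ℝ] FieldSpace n) :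
    g.PreservedBy (Jet.map Λ a T) ↔ ∀ p v w,
      g.toFun (Jet.map Λ a T p) (Jet.map Λ 0 T v) (Jet.map Λ 0 T w) = g.toFun p v w := by
  simp only [PreservedBy, Jet.fderiv_map, Jet.mapL_eq_map]

instance : Add (JetMetric d n r) :=
  ⟨fun g g' => ⟨fun p => g.toFun p + g'.toFun p, g.smooth.add g'.smooth,
    fun p v w => congrArg₂ (· + ·) (g.symm p v w) (g'.symm p v w)⟩⟩

instance : Zero (JetMetric d n r) := ⟨⟨fun _ => 0, contDiff_const, fun _ _ _ => rfl⟩⟩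

theorem add_lagrangian (g g' : JetMetric d n r) :
    (g + g').lagrangian = g.lagrangian + g'.lagrangian := by
  funext φ x
  have h : ∀ v w, (g + g').pullback φ x v w = g.pullback φ x v w + g'.pullback φ x v w :=
    fun _ _ => rfl
  simp [lagrangian, h, mul_add, Finset.sum_add_distrib]

theorem zero_lagrangian : (0 : JetMetric d n r).lagrangian = 0 := by
  funext φ x
  have h : ∀ v w, (0 : JetMetric d n r).pullback φ x v w = 0 := fun _ _ => rfl
  simp [lagrangian, h]

end JetMetric

/-- The Lagrangian of an invariant jet bundle metric. -/
def IsMetricLagrangian {d n : ℕ} (r : ℕ) {G : Type*} [Group G]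
    (ρ : Representation ℝ G (FieldSpace n)) (L : Functional d n) : Prop :=
  ∃ g : JetMetric d n r, g.PoincareInvariant ∧ g.InternalInvariant ρ ∧ g.lagrangian = L

theorem IsMetricLagrangian.add {d n r : ℕ} {G : Type*} [Group G]
    {ρ : Representation ℝ G (FieldSpace n)} {L L' : Functional d n}
    (h : IsMetricLagrangian r ρ L) (h' : IsMetricLagrangian r ρ L') :
    IsMetricLagrangian r ρ (L + L') := by
  obtain ⟨g, h₁, h₂, rfl⟩ := h
  obtain ⟨g', h₁', h₂', rfl⟩ := h'
  exact ⟨g + g', fun Λ a hΛ p v w => congrArg₂ (· + ·) (h₁ Λ a hΛ p v w) (h₁' Λ a hΛ p v w),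
    fun s p v w => congrArg₂ (· + ·) (h₂ s p v w) (h₂' s p v w), JetMetric.add_lagrangian g g'⟩

theorem isMetricLagrangian_zero {d n r : ℕ} {G : Type*} [Group G]
    {ρ : Representation ℝ G (FieldSpace n)} :
    IsMetricLagrangian r ρ (0 : Functional d n) :=
  ⟨0, fun _ _ _ _ _ _ => rfl, fun _ _ _ _ => rfl, JetMetric.zero_lagrangian⟩

theorem contDiff_smul_vector {E F : Type*} [NormedAddCommGroup E] [NormedSpace ℝ E]
    [NormedAddCommGroup F] [NormedSpace ℝ F] {f : E → ℝ} (hf : ContDiff ℝ ∞ f) (w : F) :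
    ContDiff ℝ ∞ fun p => f p • w := hf.smul contDiff_const

theorem contDiff_clm_flip {E F : Type*} [NormedAddCommGroup E] [NormedSpace ℝ E]
    [NormedAddCommGroup F] [NormedSpace ℝ F] {f : E → F →L[ℝ] F →L[ℝ] ℝ} (hf : ContDiff ℝ ∞ f) :
    ContDiff ℝ ∞ fun p => (f p).flip := by
  have e : ContDiff ℝ ∞ fun B : F →L[ℝ] F →L[ℝ] ℝ => B.flip :=
    IsBoundedLinearMap.contDiff (𝕜 := ℝ) (E := F →L[ℝ] F →L[ℝ] ℝ) (F := F →L[ℝ] F →L[ℝ] ℝ)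
      ⟨⟨fun _ _ => rfl, fun _ _ => rfl⟩, 1, one_pos, fun B => by
        rw [one_mul, ContinuousLinearMap.opNorm_flip]⟩
  exact e.comp hf

namespace Contraction

variable {d n r N k : ℕ}

/-- The bilinear form on the jet bundle obtained from a contraction pattern by inserting the first
tangent vector in the field `a`, the second in the field `b` and the jet in all other fields. -/
def bilinForm (r : ℕ) (Γ : Contraction N k) (a b : Fin N)
    (t : FieldSpace n → ContinuousMultilinearMap ℝ (fun _ : Fin N => FieldSpace n) ℝ)
    (p : Jet d n r) : Jet d n r →L[ℝ] Jet d n r →L[ℝ] ℝ :=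
  ∑ i : Fin N → Fin n, ∑ μ : Fin k → Fin d, ∑ ν : Fin k → Fin d,
    (t (Jet.value p) (fun j => Pi.single (i j) 1) * ((∏ e, (minkowski d)⁻¹ (μ e) (ν e)) *
      ∏ j ∈ (Finset.univ.erase a).erase b, Jet.coord (Γ.indicesAt μ ν j) (i j) p)) •
    (Jet.coord (Γ.indicesAt μ ν a) (i a)).smulRight (Jet.coord (Γ.indicesAt μ ν b) (i b))

theorem contDiff_bilinForm (Γ : Contraction N k) (a b : Fin N)
    {t : FieldSpace n → ContinuousMultilinearMap ℝ (fun _ : Fin N => FieldSpace n) ℝ}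
    (ht : ContDiff ℝ ∞ t) : ContDiff ℝ ∞ (Γ.bilinForm (d := d) r a b t) := by
  refine ContDiff.sum fun i _ => ContDiff.sum fun μ _ => ContDiff.sum fun ν _ =>
    contDiff_smul_vector (ContDiff.mul ?_ (contDiff_const.mul (contDiff_prod fun j _ =>
      ContinuousLinearMap.contDiff _))) _
  exact (ContinuousMultilinearMap.apply ℝ (fun _ : Fin N => FieldSpace n) ℝ _).contDiff.comp
    (ht.comp Jet.value.contDiff)

/-- Rewrites the form as a single contraction whose slots hold `v`, `w` or the jet. Spacetime and
flavour invariance then follow from the general contraction lemmas. -/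
theorem bilinForm_apply (Γ : Contraction N k) {a b : Fin N} (hab : a ≠ b)
    (t : FieldSpace n → ContinuousMultilinearMap ℝ (fun _ : Fin N => FieldSpace n) ℝ)
    (p v w : Jet d n r) : Γ.bilinForm r a b t p v w = Γ.termCoeffs (t (Jet.value p))
      fun j i l => Jet.coord l i (if j = a then v else if j = b then w else p) := by
  simp only [bilinForm, sum_apply, smul_apply, ContinuousLinearMap.smulRight_apply, smul_eq_mul,
    termCoeffs, contractCoeffs, Finset.mul_sum]
  refine Finset.sum_congr rfl fun i _ => Finset.sum_congr rfl fun μ _ =>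
    Finset.sum_congr rfl fun ν _ => ?_
  rw [← Finset.mul_prod_erase _ _ (Finset.mem_univ a),
    ← Finset.mul_prod_erase _ _ (Finset.mem_erase.2 ⟨hab.symm, Finset.mem_univ b⟩)]
  have h : ∏ j ∈ (Finset.univ.erase a).erase b, Jet.coord (Γ.indicesAt μ ν j) (i j)
      (if j = a then v else if j = b then w else p) =
      ∏ j ∈ (Finset.univ.erase a).erase b, Jet.coord (Γ.indicesAt μ ν j) (i j) p := by
    refine Finset.prod_congr rfl fun j hj => ?_
    rw [Finset.mem_erase, Finset.mem_erase] at hj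
    rw [if_neg hj.2.1, if_neg hj.1]
  rw [h, if_pos rfl, if_neg hab.symm, if_pos rfl]
  ring

theorem bilinForm_map_spacetime (Γ : Contraction N k) {a b : Fin N} (hab : a ≠ b)
    (t : FieldSpace n → ContinuousMultilinearMap ℝ (fun _ : Fin N => FieldSpace n) ℝ)
    {Λ : Spacetime d ≃L[ℝ] Spacetime d} (hΛ : IsLorentz Λ) (x : Spacetime d)
    (p v w : Jet d n r) :
    Γ.bilinForm r a b t (Jet.map Λ x (ContinuousLinearMap.id ℝ _) p)
      (Jet.map Λ 0 (ContinuousLinearMap.id ℝ _) v) (Jet.map Λ 0 (ContinuousLinearMap.id ℝ _) w) =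
      Γ.bilinForm r a b t p v w := by
  rw [bilinForm_apply Γ hab, bilinForm_apply Γ hab, Jet.value_map_spacetime]
  refine Finset.sum_congr rfl fun i _ => ?_
  congr 1
  refine Eq.trans ?_ (Γ.contractCoeffs_changeCoords hΛ.inverseMatrix_mul _)
  congr 1
  funext j l
  beta_reduce
  split_ifs <;> exact Jet.coord_map_spacetime _ _ _ _ _

theorem bilinForm_map_flavour {G : Type*} [Group G] {ρ : Representation ℝ G (FieldSpace n)}
    (Γ : Contraction N k) {a b : Fin N} (hab : a ≠ b)
    {t : FieldSpace n → ContinuousMultilinearMap ℝ (fun _ : Fin N => FieldSpace n) ℝ}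
    (ht : TensorInvariant ρ t) (g : G) (p v w : Jet d n r) :
    Γ.bilinForm r a b t (Jet.map (ContinuousLinearEquiv.refl ℝ _) 0 (flavourMap ρ g) p)
      (Jet.map (ContinuousLinearEquiv.refl ℝ _) 0 (flavourMap ρ g) v)
      (Jet.map (ContinuousLinearEquiv.refl ℝ _) 0 (flavourMap ρ g) w) =
      Γ.bilinForm r a b t p v w := by
  rw [bilinForm_apply Γ hab, bilinForm_apply Γ hab, Jet.value_map_flavour,
    Γ.termCoeffs_sum_mul _ (fun m => flavourMap ρ g (Pi.single m 1))
      (fun j m l => Jet.coord l m (if j = a then v else if j = b then w else p))]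
  · refine Finset.sum_congr rfl fun i _ => ?_
    congr 1
    exact ht g (Jet.value p) fun j => Pi.single (i j) 1
  · intro j i μ ν
    split_ifs <;> exact Jet.coord_map_flavour _ _ _ _ _

/-- The metric of a contraction pattern: the sum of `bilinForm` and its transpose. -/
def metric (r : ℕ) (Γ : Contraction N k) (a b : Fin N)
    {t : FieldSpace n → ContinuousMultilinearMap ℝ (fun _ : Fin N => FieldSpace n) ℝ}
    (ht : ContDiff ℝ ∞ t) : JetMetric d n r where
  toFun p := Γ.bilinForm r a b t p + (Γ.bilinForm r a b t p).flip
  smooth := by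
    exact (Γ.contDiff_bilinForm a b ht).add (contDiff_clm_flip (Γ.contDiff_bilinForm a b ht))
  symm p v w := add_comm _ _

/-- The tangent vectors put `∂_μ` and `∂_ν` on the two ends of pair `0`, and the trace contracts
them. The remaining `k ≤ r` pairs are box-free, so every list involved has length at most `r` and is
a genuine jet coordinate. -/
theorem metric_lagrangian (Γ : Contraction N (k + 1)) (h : Γ.BoxFree) (hk : k ≤ r)
    {t : FieldSpace n → ContinuousMultilinearMap ℝ (fun _ : Fin N => FieldSpace n) ℝ}
    (ht : ContDiff ℝ ∞ t) :
    (Γ.tail.metric (d := d) r (Γ.src 0) (Γ.tgt 0) ht).lagrangian = Γ.term d t := by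
  funext φ x
  let B : Fin d → Fin d → ℝ := fun μ ν => Γ.tail.bilinForm r (Γ.src 0) (Γ.tgt 0) t
    (prolong r φ x) (fderiv ℝ (prolong r φ) x (basisVec μ))
      (fderiv ℝ (prolong r φ) x (basisVec ν))
  have hB : ∀ μ ν, (Γ.tail.metric r (Γ.src 0) (Γ.tgt 0) ht).pullback φ x (basisVec μ)
      (basisVec ν) = B μ ν + B ν μ := fun _ _ => rfl
  have hsymm : ∀ μ ν, (minkowski d)⁻¹ μ ν = (minkowski d)⁻¹ ν μ := fun μ ν => by
    rw [minkowski_inv]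
    exact congrFun (congrFun (minkowski_transpose d) ν) μ
  -- The form and its transpose have equal traces since `η^{-1}` is symmetric; the factor `1/2` then
  -- undoes the symmetrisation.
  have hsum : ∑ μ, ∑ ν, (minkowski d)⁻¹ μ ν * B ν μ = ∑ μ, ∑ ν, (minkowski d)⁻¹ μ ν * B μ ν := by
    rw [Finset.sum_comm]
    exact Finset.sum_congr rfl fun ν _ => Finset.sum_congr rfl fun μ _ => by rw [hsymm]
  have hB' : ∀ μ ν, B μ ν = ∑ i : Fin N → Fin n, t (φ.1 x) (fun j => Pi.single (i j) 1) *
      Γ.tail.contractCoeffs (shift (Γ.tgt 0) ν (shift (Γ.src 0) μ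
        fun j l => iterD l (φ.component (i j)) x)) := by
    intro μ ν
    refine (bilinForm_apply _ (h 0) _ _ _ _).trans ?_
    rw [Jet.value_prolong]
    refine Finset.sum_congr rfl fun i _ => ?_
    congr 1
    refine contractCoeffs_congr _ fun j α β => ?_
    have hl : (Γ.tail.indicesAt α β j).length < r + 1 := by
      rw [length_indicesAt]
      exact Nat.lt_succ_of_le ((h.tail.numDerivs_le j).trans hk)
    rw [shift_shift_apply]
    beta_reduce
    rcases eq_or_ne j (Γ.src 0) with rfl | hs
    · rw [if_pos rfl, if_pos rfl, if_neg (h 0).symm, Jet.coord_fderiv_prolong hl]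
      rfl
    · rw [if_neg hs, if_neg hs.symm]
      rcases eq_or_ne j (Γ.tgt 0) with rfl | ht
      · rw [if_pos rfl, if_pos rfl, Jet.coord_fderiv_prolong hl]
        rfl
      · rw [if_neg ht, if_neg ht.symm, Jet.coord_prolong hl]
        rfl
  rw [term_eq_termCoeffs]
  simp only [JetMetric.lagrangian, hB, mul_add, Finset.sum_add_distrib, hsum]
  rw [← two_mul, ← mul_assoc, one_div, mul_inv_cancel₀ two_ne_zero, one_mul]
  simp only [hB', termCoeffs, contractCoeffs_succ, Finset.mul_sum]
  refine Eq.trans ?_ Finset.sum_comm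
  refine Finset.sum_congr rfl fun _ _ => ?_
  rw [Finset.sum_comm]
  exact Finset.sum_congr rfl fun _ _ => Finset.sum_congr rfl fun _ _ => mul_left_comm _ _ _

end Contraction

/-! ### Potentials from multiples of the Minkowski metric -/

/-- The spacetime coordinate `x^μ` of a jet. -/
def Jet.spacetimeCoord {d n r : ℕ} (μ : Fin d) : Jet d n r →L[ℝ] ℝ :=
  (ContinuousLinearMap.proj (R := ℝ) (φ := fun _ : Fin d => ℝ) μ) ∘L
    ContinuousLinearMap.fst ℝ (Spacetime d) ((k : Fin (r + 1)) → SymTensor d n (k : ℕ))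

theorem Jet.spacetimeCoord_apply {d n r : ℕ} (μ : Fin d) (p : Jet d n r) :
    Jet.spacetimeCoord μ p = p.1 μ := rfl

/-- The Minkowski metric of spacetime, as a bilinear form on the jet bundle. -/
def minkowskiForm (d n r : ℕ) : Jet d n r →L[ℝ] Jet d n r →L[ℝ] ℝ :=
  ∑ μ, minkowski d μ μ • (Jet.spacetimeCoord μ).smulRight (Jet.spacetimeCoord μ)

theorem minkowskiForm_apply {d n r : ℕ} (v w : Jet d n r) :
    minkowskiForm d n r v w = v.1 ⬝ᵥ (minkowski d).mulVec w.1 := by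
  simp only [minkowskiForm, sum_apply, smul_apply, ContinuousLinearMap.smulRight_apply,
    smul_eq_mul, Jet.spacetimeCoord_apply, dotProduct, minkowski, Matrix.mulVec_diagonal,
    Matrix.diagonal_apply_eq]
  exact Finset.sum_congr rfl fun _ _ => mul_left_comm _ _ _

namespace Contraction

variable {d n r N : ℕ}

/-- The potential of a contraction pattern without derivatives. -/
def potential (d : ℕ) (Γ : Contraction N 0)
    (t : FieldSpace n → ContinuousMultilinearMap ℝ (fun _ : Fin N => FieldSpace n) ℝ)
    (u : FieldSpace n) : ℝ :=
  Γ.termCoeffs (d := d) (t u) fun _ i _ => u i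

theorem contDiff_potential (Γ : Contraction N 0)
    {t : FieldSpace n → ContinuousMultilinearMap ℝ (fun _ : Fin N => FieldSpace n) ℝ}
    (ht : ContDiff ℝ ∞ t) : ContDiff ℝ ∞ (Γ.potential d t) := by
  refine ContDiff.sum fun i _ => ContDiff.mul ?_ (ContDiff.sum fun μ _ => ContDiff.sum fun ν _ =>
    contDiff_const.mul (contDiff_prod fun j _ => contDiff_apply _ _ _))
  exact (ContinuousMultilinearMap.apply ℝ (fun _ : Fin N => FieldSpace n) ℝ _).contDiff.comp ht

theorem potential_invariant {G : Type*} [Group G] {ρ : Representation ℝ G (FieldSpace n)}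
    (Γ : Contraction N 0)
    {t : FieldSpace n → ContinuousMultilinearMap ℝ (fun _ : Fin N => FieldSpace n) ℝ}
    (ht : TensorInvariant ρ t) (g : G) (u : FieldSpace n) :
    Γ.potential d t (ρ g u) = Γ.potential d t u := by
  unfold potential
  rw [Γ.termCoeffs_sum_mul _ (fun m => ρ g (Pi.single m 1)) fun _ m _ => u m]
  · refine Finset.sum_congr rfl fun i _ => ?_
    congr 1
    exact ht g u fun j => Pi.single (i j) 1
  · intro j i μ ν
    conv_lhs => rw [pi_eq_sum_univ' u]
    simp [mul_comm]

theorem potential_eq_term (Γ : Contraction N 0)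
    (t : FieldSpace n → ContinuousMultilinearMap ℝ (fun _ : Fin N => FieldSpace n) ℝ)
    (φ : Config d n) (x : Spacetime d) : Γ.potential d t (φ.1 x) = Γ.term d t φ x := by
  rw [term_eq_termCoeffs, potential]
  refine Γ.termCoeffs_congr _ fun j i μ ν => ?_
  have h : Γ.indicesAt μ ν j = [] := by simp [indicesAt]
  rw [h]
  rfl

/-- The metric `(2 / d) V η` with a potential `V`. -/
def potentialMetric (d r : ℕ) (Γ : Contraction N 0)
    {t : FieldSpace n → ContinuousMultilinearMap ℝ (fun _ : Fin N => FieldSpace n) ℝ}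
    (ht : ContDiff ℝ ∞ t) : JetMetric d n r where
  toFun p := ((2 / d : ℝ) * Γ.potential d t (Jet.value p)) • minkowskiForm d n r
  smooth := contDiff_smul_vector (contDiff_const.mul ((Γ.contDiff_potential ht).comp
    Jet.value.contDiff)) _
  symm p v w := by
    rw [smul_apply, smul_apply, smul_apply, smul_apply, minkowskiForm_apply, minkowskiForm_apply,
      Matrix.dotProduct_mulVec, ← Matrix.mulVec_transpose, minkowski_transpose, dotProduct_comm]

theorem potentialMetric_lagrangian (hd : 1 ≤ d) (Γ : Contraction N 0)
    {t : FieldSpace n → ContinuousMultilinearMap ℝ (fun _ : Fin N => FieldSpace n) ℝ}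
    (ht : ContDiff ℝ ∞ t) : (Γ.potentialMetric d r ht).lagrangian = Γ.term d t := by
  funext φ x
  have h : ∀ μ ν, (Γ.potentialMetric d r ht).pullback φ x (basisVec μ) (basisVec ν) =
      (2 / d : ℝ) * Γ.term d t φ x * minkowski d μ ν := by
    intro μ ν
    change ((2 / d : ℝ) * Γ.potential d t (Jet.value (prolong r φ x))) *
      minkowskiForm d n r _ _ = _
    rw [minkowskiForm_apply, Jet.fst_fderiv_prolong, Jet.fst_fderiv_prolong, Jet.value_prolong,
      potential_eq_term]
    simp [basisVec]
  -- The trace is `d`, which fixes the factor `2 / d` in the metric: `1/2 * (2 / d) * d = 1`.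
  have htr : ∑ μ, ∑ ν, (minkowski d)⁻¹ μ ν * minkowski d μ ν = d := by
    have h₁ := congrArg Matrix.trace (minkowski_mul_self d)
    rw [Matrix.trace_one, Fintype.card_fin] at h₁
    rw [minkowski_inv, ← h₁]
    refine Finset.sum_congr rfl fun μ _ => Finset.sum_congr rfl fun ν _ => ?_
    congr 1
    exact congrFun (congrFun (minkowski_transpose d) ν) μ
  simp only [JetMetric.lagrangian, h]
  have : ∀ μ ν, (minkowski d)⁻¹ μ ν * ((2 / d : ℝ) * Γ.term d t φ x * minkowski d μ ν) =
      (2 / d : ℝ) * Γ.term d t φ x * ((minkowski d)⁻¹ μ ν * minkowski d μ ν) := fun _ _ => by ring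
  simp only [this, ← Finset.mul_sum, htr]
  have hd' : (d : ℝ) ≠ 0 := by positivity
  field_simp

theorem isMetricLagrangian_term {k : ℕ} {G : Type*} [Group G]
    {ρ : Representation ℝ G (FieldSpace n)} (hd : 1 ≤ d) (Γ : Contraction N k) (h : Γ.BoxFree)
    (hk : k ≤ r + 1)
    {t : FieldSpace n → ContinuousMultilinearMap ℝ (fun _ : Fin N => FieldSpace n) ℝ}
    (ht : ContDiff ℝ ∞ t) (hρ : TensorInvariant ρ t) :
    IsMetricLagrangian r ρ (Γ.term d t) := by
  cases k with
  | zero =>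
    refine ⟨Γ.potentialMetric d r ht, fun Λ a hΛ => ?_, fun g => ?_,
      Γ.potentialMetric_lagrangian hd ht⟩
    · rw [JetMetric.preservedBy_map_iff]
      intro p v w
      change ((2 / d : ℝ) * Γ.potential d t (Jet.value _)) * minkowskiForm d n r _ _ =
        ((2 / d : ℝ) * Γ.potential d t (Jet.value p)) * minkowskiForm d n r v w
      rw [Jet.value_map_spacetime, minkowskiForm_apply, minkowskiForm_apply, ← hΛ v.1 w.1]
      simp [Jet.map]
    · rw [JetMetric.preservedBy_map_iff]
      intro p v w
      change ((2 / d : ℝ) * Γ.potential d t (Jet.value _)) * minkowskiForm d n r _ _ =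
        ((2 / d : ℝ) * Γ.potential d t (Jet.value p)) * minkowskiForm d n r v w
      have h₁ : ∀ v : Jet d n r, (Jet.map (ContinuousLinearEquiv.refl ℝ (Spacetime d)) 0
          (flavourMap ρ g) v).1 = v.1 := fun v => add_zero v.1
      rw [Jet.value_map_flavour, minkowskiForm_apply, minkowskiForm_apply, h₁, h₁]
      congr 2
      exact Γ.potential_invariant hρ g _
  | succ k =>
    refine ⟨Γ.tail.metric r (Γ.src 0) (Γ.tgt 0) ht, fun Λ a hΛ => ?_, fun g => ?_,
      Γ.metric_lagrangian h (Nat.le_of_succ_le_succ hk) ht⟩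
    · rw [JetMetric.preservedBy_map_iff]
      exact fun p v w => congrArg₂ (· + ·) (bilinForm_map_spacetime _ (h 0) t hΛ a p v w)
        (bilinForm_map_spacetime _ (h 0) t hΛ a p w v)
    · rw [JetMetric.preservedBy_map_iff]
      exact fun p v w => congrArg₂ (· + ·) (bilinForm_map_flavour _ (h 0) hρ g p v w)
        (bilinForm_map_flavour _ (h 0) hρ g p w v)

end Contraction

/-! ### Separation of the numbers of fields and derivatives -/

/-- The configuration `x ↦ c φ(s x)`. -/
def Config.rescale {d n : ℕ} (c s : ℝ) (φ : Config d n) : Config d n :=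
  ⟨fun x => c • φ.1 (s • x), (φ.2.comp (contDiff_id.const_smul s)).const_smul c⟩

/-- The functional `L'` with `L'[φ](x) = L[c φ(s ·)](x / s)`. -/
def rescaling (d n : ℕ) (c s : ℝ) : Functional d n →ₗ[ℝ] Functional d n where
  toFun L φ x := L (φ.rescale c s) (s⁻¹ • x)
  map_add' _ _ := rfl
  map_smul' _ _ := rfl

theorem partialD_comp_smul {d : ℕ} (μ : Fin d) (s : ℝ) (f : Spacetime d → ℝ) :
    partialD μ (fun x => f (s • x)) = fun x => s * partialD μ f (s • x) := by
  funext x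
  unfold partialD
  rw [fderiv_comp_smul, smul_apply, smul_eq_mul]

theorem iterD_rescale {d n : ℕ} (c s : ℝ) (φ : Config d n) (i : Fin n) (l : List (Fin d)) :
    iterD l ((φ.rescale c s).component i) =
      fun x => c * s ^ l.length * iterD l (φ.component i) (s • x) := by
  induction l with
  | nil =>
    funext x
    simp [iterD, Config.component, Config.rescale]
  | cons μ l ih =>
    have h := partialD_sum_mul Finset.univ μ (fun _ : Unit => c * s ^ l.length)
      (f := fun _ x => iterD l (φ.component i) (s • x)) fun _ =>
        (contDiff_iterD l (φ.contDiff_component i)).comp (contDiff_id.const_smul s)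
    simp only [Finset.univ_unique, Finset.sum_singleton] at h
    rw [iterD_cons, ih, h, partialD_comp_smul]
    funext x
    rw [List.length_cons, iterD_cons]
    ring

theorem rescaling_mem_localFunctionals {d n : ℕ} {c s : ℝ} (hs : s ≠ 0) {J : Functional d n}
    (hJ : J ∈ localFunctionals d n) : rescaling d n c s J ∈ localFunctionals d n := by
  induction hJ using Submodule.span_induction with
  | mem F hF =>
    obtain ⟨N, A, i, α, hA, rfl⟩ := hF
    -- Evaluating at `s⁻¹ • x` returns every derivative to the point `x`, so the scale factors are
    -- constants that can be absorbed in `A`.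
    refine Submodule.subset_span ⟨N, fun u => A (c • u) * ∏ j, c * s ^ (α j).length, i, α,
      (hA.comp (contDiff_id.const_smul c)).mul contDiff_const, ?_⟩
    funext φ x
    change A (c • φ.1 (s • s⁻¹ • x)) * ∏ j, iterD (α j) ((φ.rescale c s).component (i j))
      (s⁻¹ • x) = _
    simp only [iterD_rescale, smul_inv_smul₀ hs, Finset.prod_mul_distrib, mul_assoc]
  | zero => rw [map_zero]; exact Submodule.zero_mem _
  | add F F' _ _ hF hF' => rw [map_add]; exact Submodule.add_mem _ hF hF'
  | smul a F _ hF => rw [map_smul]; exact Submodule.smul_mem _ _ hF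

theorem totalDerivatives_le_comap_rescaling {d n : ℕ} {c s : ℝ} (hs : s ≠ 0) :
    totalDerivatives d n ≤ (totalDerivatives d n).comap (rescaling d n c s) := by
  refine Submodule.span_le.2 ?_
  rintro _ ⟨μ, J, hJ, rfl⟩
  have h : rescaling d n c s (fun φ => partialD μ (J φ)) =
      s • fun φ => partialD μ (rescaling d n c s J φ) := by
    funext φ x
    change partialD μ (J (φ.rescale c s)) (s⁻¹ • x) =
      s * partialD μ (fun x => J (φ.rescale c s) (s⁻¹ • x)) x
    rw [partialD_comp_smul, mul_inv_cancel_left₀ hs]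
  change rescaling d n c s (fun φ => partialD μ (J φ)) ∈ totalDerivatives d n
  rw [h]
  exact Submodule.smul_mem _ _ (Submodule.subset_span
    ⟨μ, _, rescaling_mem_localFunctionals hs hJ, rfl⟩)

theorem rescaling_functional {d n : ℕ} {c s : ℝ} (hs : s ≠ 0) (O : Operator n) :
    rescaling d n c s (O.functional d) = (c ^ O.N * s ^ (2 * O.k)) • O.functional d := by
  funext φ x
  have h : ∀ i : Fin O.N → Fin n, O.graph.contract
      (fun j => (φ.rescale c s).component (i j)) (s⁻¹ • x) =
      c ^ O.N * s ^ (2 * O.k) * O.graph.contract (fun j => φ.component (i j)) x := by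
    intro i
    simp only [Contraction.contract, iterD_rescale, smul_inv_smul₀ hs, Finset.prod_mul_distrib,
      Contraction.length_indicesAt, Finset.prod_pow_eq_pow_sum, Contraction.sum_numDerivs,
      Finset.prod_const, Finset.card_univ, Fintype.card_fin, Finset.mul_sum]
    exact Finset.sum_congr rfl fun _ _ => Finset.sum_congr rfl fun _ _ => mul_left_comm _ _ _
  change ∑ i : Fin O.N → Fin n, O.tensor (fun j => Pi.single (i j) 1) * O.graph.contract
    (fun j => (φ.rescale c s).component (i j)) (s⁻¹ • x) =
    (c ^ O.N * s ^ (2 * O.k)) * ∑ i : Fin O.N → Fin n, O.tensor (fun j => Pi.single (i j) 1) *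
      O.graph.contract (fun j => φ.component (i j)) x
  rw [Finset.mul_sum]
  refine Finset.sum_congr rfl fun i _ => ?_
  rw [h, mul_left_comm]

/-- The rescaling `φ(x) ↦ 2 φ(3 x)` modulo total derivatives. -/
def rescalingMod (d n : ℕ) : Module.End ℝ (Functional d n ⧸ totalDerivatives d n) :=
  (totalDerivatives d n).mapQ _ (rescaling d n 2 3)
    (totalDerivatives_le_comap_rescaling (by norm_num))

/-- An operator, as a functional modulo total derivatives. -/
def Operator.modIBP (d : ℕ) {n : ℕ} (O : Operator n) : Functional d n ⧸ totalDerivatives d n :=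
  (totalDerivatives d n).mkQ (O.functional d)

theorem Operator.modIBP_mem_eigenspace (d : ℕ) {n : ℕ} (O : Operator n) :
    O.modIBP d ∈ (rescalingMod d n).eigenspace (2 ^ O.N * 3 ^ (2 * O.k)) := by
  rw [Module.End.mem_eigenspace_iff, modIBP, rescalingMod, Submodule.mkQ_apply,
    Submodule.mapQ_apply, rescaling_functional (by norm_num), Submodule.Quotient.mk_smul]

/-- Unique factorisation recovers `N` and `k` from the exponents of 2 and 3; this is why these scale
factors are used. -/
theorem eigenvalue_injective :
    Function.Injective fun p : ℕ × ℕ => (2 ^ p.1 * 3 ^ (2 * p.2) : ℝ) := by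
  rintro ⟨N, k⟩ ⟨N', k'⟩ h
  have h' : 2 ^ N * 3 ^ (2 * k) = 2 ^ N' * 3 ^ (2 * k') := by
    beta_reduce at h
    exact_mod_cast h
  have h₂ := congrArg (fun m => m.factorization 2) h'
  have h₃ := congrArg (fun m => m.factorization 3) h'
  have e₁ : ∀ a b : ℕ, (2 ^ a * 3 ^ b).factorization 2 = a := fun a b => by
    rw [Nat.factorization_mul (by positivity) (by positivity), Nat.prime_two.factorization_pow,
      Nat.prime_three.factorization_pow]
    simp
  have e₂ : ∀ a b : ℕ, (2 ^ a * 3 ^ b).factorization 3 = b := fun a b => by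
    rw [Nat.factorization_mul (by positivity) (by positivity), Nat.prime_two.factorization_pow,
      Nat.prime_three.factorization_pow]
    simp
  simp only [e₁, e₂] at h₂ h₃
  ext <;> simp <;> omega

theorem mem_sup_of_le_left {M : Type*} [AddCommGroup M] [Module ℝ M] {S S' : Submodule ℝ M}
    (T : Submodule ℝ M) (h : S ≤ S') {x : M} (hx : x ∈ S ⊔ T) : x ∈ S' ⊔ T :=
  (sup_le_sup_right h T : S ⊔ T ≤ S' ⊔ T) hx

/-- The sectors lie in eigenspaces of `rescalingMod` with distinct eigenvalues, and such eigenspaces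
are independent. -/
theorem linearIndepOn_iUnion_of_sector {d n : ℕ} {B : ℕ × ℕ → Set (Operator n)}
    (hB : ∀ p, ∀ O ∈ B p, (O.N, O.k) = p)
    (hli : ∀ p, LinearIndepOn ℝ (Operator.modIBP d) (B p)) :
    LinearIndepOn ℝ (Operator.modIBP d) (⋃ p, B p) := by
  have hind : iSupIndep fun p : ℕ × ℕ =>
      (rescalingMod d n).eigenspace (2 ^ p.1 * 3 ^ (2 * p.2)) :=
    (rescalingMod d n).eigenspaces_iSupIndep.comp eigenvalue_injective
  have hspan : ∀ p, Submodule.span ℝ (Set.range fun O : B p => O.1.modIBP d) ≤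
      (rescalingMod d n).eigenspace (2 ^ p.1 * 3 ^ (2 * p.2)) := by
    intro p
    refine Submodule.span_le.2 ?_
    rintro _ ⟨O, rfl⟩
    have h := O.1.modIBP_mem_eigenspace d
    have hN : O.1.N = p.1 := congrArg Prod.fst (hB p O.1 O.2)
    have hk : O.1.k = p.2 := congrArg Prod.snd (hB p O.1 O.2)
    rw [hN, hk] at h
    exact h
  have h := linearIndependent_iUnion_finite (R := ℝ) (f := fun p (O : B p) => O.1.modIBP d) hli
    fun p t _ hp => (hind.disjoint_biSup hp).mono (hspan p)
      (iSup₂_mono fun q _ => hspan q)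
  -- An operator knows its own sector, so the union embeds in the disjoint union.
  let e : (⋃ p, B p) → Σ p, B p := fun O =>
    ⟨(O.1.N, O.1.k), O.1, by
      obtain ⟨p, hp⟩ := Set.mem_iUnion.1 O.2
      rwa [hB p O.1 hp]⟩
  exact h.comp e fun O O' hO => Subtype.ext (congrArg (fun q : Σ p, B p => q.2.1) hO)

/-! ### Construction of the Green's basis -/

/-- The box-free operators with invariant flavour tensors, `N` fields and `2 k` derivatives. -/
def sectorOperators {n : ℕ} (r : ℕ) {G : Type*} [Group G]
    (ρ : Representation ℝ G (FieldSpace n)) (p : ℕ × ℕ) : Set (Operator n) :=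
  {O | (O.N, O.k) = p ∧ O.k ≤ r + 1 ∧ O.graph.BoxFree ∧ O.IsInvariant ρ}

theorem mem_span_sectorOperators {d n r N k : ℕ} {G : Type*} [Group G]
    {ρ : Representation ℝ G (FieldSpace n)} (hk : k ≤ r + 1) {L : Functional d n}
    (hL : L ∈ homogeneousLagrangians d n N k) (hρ : Functional.IsInvariant ρ L) :
    L ∈ Submodule.span ℝ (Operator.functional d '' sectorOperators r ρ (N, k)) ⊔
      totalDerivatives d n := by
  obtain ⟨t, ht, rfl⟩ := exists_invariant_tensors hL hρ
  refine Submodule.sum_mem _ fun Γ _ => ?_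
  refine mem_sup_of_le_left _ (Submodule.span_mono ?_) (Γ.term_const_mem (t Γ))
  rintro _ ⟨Γ', hΓ', rfl⟩
  exact ⟨⟨N, k, Γ', t Γ⟩, ⟨rfl, hk, hΓ', ht Γ⟩, rfl⟩

/-- A maximal independent subset of each sector spans that sector modulo total derivatives; since
sectors are treated separately, completeness respects `N` and `k`. -/
theorem exists_green_basis {n : ℕ} (d r : ℕ) {G : Type*} [Group G]
    (ρ : Representation ℝ G (FieldSpace n)) :
    ∃ B : Set (Operator n),
      (∀ O ∈ B, O.k ≤ r + 1 ∧ O.graph.BoxFree ∧ (∀ j, O.graph.numDerivs j ≤ r + 1) ∧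
        O.IsInvariant ρ) ∧
      LinearIndepOn ℝ (fun O => (totalDerivatives d n).mkQ (O.functional d)) B ∧
      ∀ N k : ℕ, k ≤ r + 1 → ∀ L ∈ homogeneousLagrangians d n N k,
        Functional.IsInvariant ρ L →
          L ∈ Submodule.span ℝ ((fun O : Operator n => O.functional d) ''
            {O ∈ B | O.N = N ∧ O.k = k}) ⊔ totalDerivatives d n := by
  choose B hBS _ hspan hli using fun p => exists_linearIndepOn_extension
    (linearIndepOn_empty ℝ (Operator.modIBP d)) (Set.empty_subset (sectorOperators r ρ p))
  refine ⟨⋃ p, B p, fun O hO => ?_, linearIndepOn_iUnion_of_sector (fun p O hO => (hBS p hO).1) hli,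
    fun N k hk L hL hρ => ?_⟩
  · obtain ⟨p, hp⟩ := Set.mem_iUnion.1 hO
    obtain ⟨_, h₁, h₂, h₃⟩ := hBS p hp
    exact ⟨h₁, h₂, fun j => (h₂.numDerivs_le j).trans h₁, h₃⟩
  · have h := mem_span_sectorOperators hk hL hρ
    -- Membership modulo total derivatives is membership in a span inside the quotient, where the
    -- basis was chosen.
    have h₁ : ∀ (S : Set (Operator n)), Submodule.span ℝ (Operator.functional d '' S) ⊔
        totalDerivatives d n = (Submodule.span ℝ (Operator.modIBP d '' S)).comap
          (totalDerivatives d n).mkQ := by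
      intro S
      have : Operator.modIBP d '' S =
          (totalDerivatives d n).mkQ '' (Operator.functional d '' S) := by
        rw [Set.image_image]
        rfl
      rw [this, ← Submodule.map_span, Submodule.comap_map_mkQ, sup_comm]
    have h₂ : B (N, k) ⊆ {O ∈ ⋃ p, B p | O.N = N ∧ O.k = k} := fun O hO =>
      ⟨Set.mem_iUnion.2 ⟨_, hO⟩, by simpa using (hBS _ hO).1⟩
    refine mem_sup_of_le_left _ (Submodule.span_mono (Set.image_mono h₂)) ?_
    change L ∈ Submodule.span ℝ (Operator.functional d '' B (N, k)) ⊔ totalDerivatives d n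
    rw [h₁] at h ⊢
    exact Submodule.span_le.2 (hspan (N, k)) h

/-! ### Reduction of Lagrangians to box-free ones -/

theorem lagrangians_le_lagrangiansWith (d n r : ℕ) :
    lagrangians d n r ≤ lagrangiansWith d n r False := by
  refine Submodule.span_mono ?_
  rintro _ ⟨N, k, Γ, t, hk, ht, rfl⟩
  exact ⟨N, k, Γ, t, hk, False.elim, ht, rfl⟩

theorem boxFreeLagrangians_le_lagrangiansWith (d n r : ℕ) :
    boxFreeLagrangians d n r ≤ lagrangiansWith d n r True := by
  refine Submodule.span_mono ?_
  rintro _ ⟨N, k, Γ, t, hk, hΓ, _, ht, rfl⟩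
  exact ⟨N, k, Γ, t, hk, fun _ => hΓ, ht, rfl⟩

theorem covariantBoxFree_le_boxFreeLagrangians {d n r k : ℕ} {G : Type*} [Group G]
    {ρ : Representation ℝ G (FieldSpace n)} (hk : k ≤ r + 1) :
    covariantBoxFree d ρ k ≤ boxFreeLagrangians d n r := by
  refine Submodule.span_mono ?_
  rintro _ ⟨N, Γ, t, hΓ, ht, _, rfl⟩
  exact ⟨N, k, Γ, t, hk, hΓ, fun j => (hΓ.numDerivs_le j).trans hk, ht, rfl⟩

/-- The invariant functionals. -/
def invariantFunctionals (d : ℕ) {n : ℕ} {G : Type*} [Group G]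
    (ρ : Representation ℝ G (FieldSpace n)) : Submodule ℝ (Functional d n) where
  carrier := {L | Functional.IsInvariant ρ L}
  add_mem' h h' g φ := congrArg₂ (· + ·) (h g φ) (h' g φ)
  zero_mem' _ _ := rfl
  smul_mem' c _ h g φ := congrArg (c • ·) (h g φ)

theorem covariantBoxFree_le_invariantFunctionals {d n k : ℕ} {G : Type*} [Group G]
    {ρ : Representation ℝ G (FieldSpace n)} :
    covariantBoxFree d ρ k ≤ invariantFunctionals d ρ := by
  refine Submodule.span_le.2 ?_
  rintro _ ⟨N, Γ, t, _, _, hρ, rfl⟩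
  exact Γ.term_isInvariant hρ

/-- Covariant tensors are chosen before integrating by parts. Every box-free term produced is then
invariant by itself, hence so is their sum `L'`. -/
theorem exists_boxFree_lagrangian {d n r : ℕ} {G : Type*} [Group G]
    {ρ : Representation ℝ G (FieldSpace n)} {L : Functional d n} (hL : L ∈ lagrangians d n r)
    (hρ : Functional.IsInvariant ρ L) :
    ∃ L' ∈ boxFreeLagrangians d n r, Functional.IsInvariant ρ L' ∧
      L - L' ∈ totalDerivatives d n := by
  obtain ⟨t, ht, rfl⟩ := exists_covariant_tensors (lagrangians_le_lagrangiansWith d n r hL) hρ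
  have h : ∑ N ∈ Finset.range (2 * r + 3), ∑ q,
      ((ContractionFamily.differentiated r False N).graph q).term d (t N q) ∈
      (boxFreeLagrangians d n r ⊓ invariantFunctionals d ρ) ⊔ totalDerivatives d n :=
    Submodule.sum_mem _ fun N hN => Submodule.sum_mem _ fun q _ =>
      mem_sup_of_le_left _ (le_inf (covariantBoxFree_le_boxFreeLagrangians
        (Nat.le_of_lt_succ q.1.1.2)) covariantBoxFree_le_invariantFunctionals)
        (Contraction.term_mem_covariantBoxFree _ (ht N hN q).1 (ht N hN q).2)
  obtain ⟨L', hL', D, hD, hLD⟩ := Submodule.mem_sup.1 h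
  exact ⟨L', hL'.1, hL'.2, by rwa [← hLD, add_sub_cancel_left]⟩

/-- Passing to covariant tensors within the box-free patterns makes each term separately the
Lagrangian of an invariant metric, and metrics add. -/
theorem isMetricLagrangian_of_boxFree {d n r : ℕ} (hd : 1 ≤ d) {G : Type*} [Group G]
    {ρ : Representation ℝ G (FieldSpace n)} {L : Functional d n}
    (hL : L ∈ boxFreeLagrangians d n r) (hρ : Functional.IsInvariant ρ L) :
    IsMetricLagrangian r ρ L := by
  obtain ⟨t, ht, rfl⟩ :=
    exists_covariant_tensors (boxFreeLagrangians_le_lagrangiansWith d n r hL) hρ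
  refine Finset.sum_induction _ (IsMetricLagrangian r ρ) (fun _ _ => IsMetricLagrangian.add)
    isMetricLagrangian_zero fun N hN => ?_
  refine Finset.sum_induction _ (IsMetricLagrangian r ρ) (fun _ _ => IsMetricLagrangian.add)
    isMetricLagrangian_zero fun q _ => ?_
  exact Contraction.isMetricLagrangian_term hd _ (q.2.2 trivial) (Nat.le_of_lt_succ q.1.1.2)
    (ht N hN q).1 (ht N hN q).2

end

end JetEFT

theorem mainTheorem1 (d n r : ℕ) (hd : 1 ≤ d) {G : Type*} [Group G]
    (ρ : Representation ℝ G (JetEFT.FieldSpace n)) :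
    -- (1) a complete Green's basis, non-redundant under integration by parts, without boxes
    (∃ B : Set (JetEFT.Operator n),
      (∀ O ∈ B, O.k ≤ r + 1 ∧ O.graph.BoxFree ∧ (∀ j, O.graph.numDerivs j ≤ r + 1) ∧
        O.IsInvariant ρ) ∧
      LinearIndepOn ℝ (fun O => (JetEFT.totalDerivatives d n).mkQ (O.functional d)) B ∧
      ∀ N k : ℕ, k ≤ r + 1 → ∀ L ∈ JetEFT.homogeneousLagrangians d n N k,
        JetEFT.Functional.IsInvariant ρ L →
          L ∈ Submodule.span ℝ ((fun O : JetEFT.Operator n => O.functional d) ''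
            {O ∈ B | O.N = N ∧ O.k = k}) ⊔ JetEFT.totalDerivatives d n) ∧
    -- (1') the same completeness for Lagrangians whose coefficients are functions of the fields
    (∀ L ∈ JetEFT.lagrangians d n r, JetEFT.Functional.IsInvariant ρ L →
      ∃ L' ∈ JetEFT.boxFreeLagrangians d n r, JetEFT.Functional.IsInvariant ρ L' ∧
        L - L' ∈ JetEFT.totalDerivatives d n) ∧
    -- (2) box-free Lagrangians are exactly reproduced by invariant jet bundle metrics
    (∀ L ∈ JetEFT.boxFreeLagrangians d n r, JetEFT.Functional.IsInvariant ρ L →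
      ∃ g : JetEFT.JetMetric d n r, g.PoincareInvariant ∧ g.InternalInvariant ρ ∧
        g.lagrangian = L) ∧
    -- the map from metrics to Lagrangians is surjective modulo integration by parts
    (∀ L ∈ JetEFT.lagrangians d n r, JetEFT.Functional.IsInvariant ρ L →
      ∃ g : JetEFT.JetMetric d n r, g.PoincareInvariant ∧ g.InternalInvariant ρ ∧
        L - g.lagrangian ∈ JetEFT.totalDerivatives d n) := by
  refine ⟨JetEFT.exists_green_basis d r ρ, fun L hL hρ => JetEFT.exists_boxFree_lagrangian hL hρ,
    fun L hL hρ => JetEFT.isMetricLagrangian_of_boxFree hd hL hρ, fun L hL hρ => ?_⟩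
  obtain ⟨L', hL', hρ', hD⟩ := JetEFT.exists_boxFree_lagrangian hL hρ
  obtain ⟨g, hg, hg', rfl⟩ := JetEFT.isMetricLagrangian_of_boxFree hd hL' hρ'
  exact ⟨g, hg, hg', hD⟩
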